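/- For $0<\lambda<1$ and $\theta=\arcsin\sqrt\lambda$, let $P_k^{\phi}(\lambda)=\big|\big(G^k(\sin\theta,\cos\theta)^{T}\big)_1\big|^2$ be the success probability of amplitude amplification after $k$ iterations with phase $\phi$, when $\lambda$ is the fraction of target items, where $$G=\begin{pmatrix}-e^{i\phi}(e^{i\phi}\sin^2\theta+\cos^2\theta)&(1-e^{i\phi})\sin\theta\cos\theta\\ e^{i\phi}(1-e^{i\phi})\sin\theta\cos\theta&-e^{i\phi}\cos^2\theta-\sin^2\theta\end{pmatrix}.$$ Fix integers $k\ge1$ and $n\ge1$, and put $\Lambda_k=\big[\sin^2\frac{\pi}{4k+2},\,\sin^2\frac{\pi}{4k-2}\big)$ and $$\phi_k^{\min}=\arccos\Big(1-\frac{2-2\cos\frac{\pi}{2k+1}}{1-\cos\frac{\pi}{2k-1}}\Big).$$ Call $(\phi_1,\dots,\phi_n)$ admissible if $\pi\ge\phi_1>\phi_2>\dots>\phi_n>\phi_k^{\min}$. Call an admissible tuple optimal if, among all admissible tuples of length $n$, it maximises the minimum success probability on $\Lambda_k$, that is, the quantity $$\sup_{s}\ \inf_{\lambda\in\Lambda_k}P_k^{\phi_{s(\lambda)}}(\lambda),$$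 where $s:\Lambda_k\to\{1,\dots,n\}$ ranges over all subdivisions of $\Lambda_k$ into $n$ parts (the phase $\phi_m$ being used on the part $s^{-1}(m)$). Theorem. Let $(\phi_1,\dots,\phi_n)$ be admissible. For $1\le m\le n-1$ the curves $P_k^{\phi_m}$ and $P_k^{\phi_{m+1}}$ intersect in exactly one point $a_m$ of $\Lambda_k$. Put $a_0=\sin^2\frac{\pi}{4k+2}$, and let $$\lambda_{\mathrm{key}}=\begin{cases}\dfrac{5-4\cos\phi_n}{6-6\cos\phi_n},&k=1,\\[2mm]\sin^2\dfrac{\pi}{4k-2},&k\ge2.\end{cases}$$ Then $(\phi_1,\dots,\phi_n)$ is optimal if and only if $$P_k^{\phi_1}(a_0)=P_k^{\phi_2}(a_1)=\dots=P_k^{\phi_m}(a_{m-1})=\dots=P_k^{\phi_n}(a_{n-1})=P_k^{\phi_n}(\lambda_{\mathrm{key}}).$$ -/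

import Mathlib

noncomputable section

namespace MultiphaseSearch

/-- Matrix of the Grover iteration `G(φ, φ) = -H S₀^φ H S_f^φ` with matched phases, in the orthonormal
basis (target state `|α⟩`, non-target state `|β⟩`), where `sin² θ` is the fraction of target items. -/
def groverMatrix (φ θ : ℝ) : Matrix (Fin 2) (Fin 2) ℂ :=
  let e : ℂ := Complex.exp (Complex.I * φ)
  let s : ℂ := (Real.sin θ : ℂ)
  let c : ℂ := (Real.cos θ : ℂ)
  !![-e * (e * s ^ 2 + c ^ 2), (1 - e) * s * c;
     e * (1 - e) * s * c, -e * c ^ 2 - s ^ 2]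

/-- The initial state `sin θ |α⟩ + cos θ |β⟩`. -/
def initialState (θ : ℝ) : Fin 2 → ℂ := ![(Real.sin θ : ℂ), (Real.cos θ : ℂ)]

/-- `P_k^φ(lam)`: the probability of measuring a target item after `k` iterations with phase `φ`,
when the fraction of target items is `lam`. -/
def successProb (k : ℕ) (φ lam : ℝ) : ℝ :=
  let θ := Real.arcsin (Real.sqrt lam)
  Complex.normSq (((groverMatrix φ θ) ^ k).mulVec (initialState θ) 0)

/-- `sin²(π / (4k + 2))`, which is `1` for `k = 0`. -/
def piMax (k : ℕ) : ℝ := Real.sin (Real.pi / (4 * (k : ℝ) + 2)) ^ 2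

/-- The range `Λ_k = [sin²(π/(4k+2)), sin²(π/(4k-2)))`, for `k ≥ 1`. -/
def range (k : ℕ) : Set ℝ := Set.Ico (piMax k) (piMax (k - 1))

/-- The lower end `φ_k^min` of the phases used on `Λ_k`. -/
def phaseMin (k : ℕ) : ℝ :=
  Real.arccos (1 - (2 - 2 * Real.cos (Real.pi / (2 * (k : ℝ) + 1))) /
    (1 - Real.cos (Real.pi / (2 * (k : ℝ) - 1))))

/-- `φ 1 > φ 2 > ⋯ > φ n` are phases in `(φ_k^min, π]`. Other indices are irrelevant. -/
def AdmissiblePhases (k n : ℕ) (φ : ℕ → ℝ) : Prop :=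
  (∀ m ∈ Set.Icc 1 n, φ m ∈ Set.Ioc (phaseMin k) Real.pi) ∧ StrictAntiOn φ (Set.Icc 1 n)

/-- A subdivision of `Λ_k` into `n` parts: the point `lam` lies in the part with number `s lam`. -/
def Subdivision (k n : ℕ) : Type := {s : range k → ℕ // ∀ lam, s lam ∈ Set.Icc 1 n}

/-- Minimum (infimum) over `Λ_k` of the success probability of the algorithm that runs `k`
iterations with phase `φ m` on the `m`-th part of the given subdivision. -/
def minSuccessOn (k n : ℕ) (φ : ℕ → ℝ) (s : Subdivision k n) : ℝ :=
  ⨅ lam : range k, successProb k (φ (s.1 lam)) lam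

/-- The minimum success probability on `Λ_k` with the phases `φ 1, …, φ n`, each phase being used
on its part of the best subdivision. -/
def minSuccess (k n : ℕ) (φ : ℕ → ℝ) : ℝ := ⨆ s : Subdivision k n, minSuccessOn k n φ s

/-- The phases `φ 1 > ⋯ > φ n` yield the largest minimum success probability on `Λ_k`. -/
def OptimalPhases (k n : ℕ) (φ : ℕ → ℝ) : Prop :=
  AdmissiblePhases k n φ ∧ ∀ ψ : ℕ → ℝ, AdmissiblePhases k n ψ → minSuccess k n ψ ≤ minSuccess k n φ

/-- `x` is a point of intersection, on `Λ_k`, of the curves with phases `φ` and `ψ`. -/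
def IsCrossing (k : ℕ) (φ ψ x : ℝ) : Prop :=
  x ∈ range k ∧ successProb k φ x = successProb k ψ x

/-- The division points `a_{k,0}, …, a_{k,n}`: the end points of `Λ_k`, and between them the
intersections of consecutive curves. -/
def IsDivision (k n : ℕ) (φ a : ℕ → ℝ) : Prop :=
  a 0 = piMax k ∧ a n = piMax (k - 1) ∧
    ∀ m, 1 ≤ m → m < n → IsCrossing k (φ m) (φ (m + 1)) (a m)

/-- `λ_key`, where `φ` is the smallest phase. -/
def lamKey (k : ℕ) (φ : ℝ) : ℝ :=
  if k = 1 then (5 - 4 * Real.cos φ) / (6 - 6 * Real.cos φ) else piMax (k - 1)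

end MultiphaseSearch

end

/-!
Put `c = sin² (φ / 2)`. By Cayley–Hamilton the second entry of `G ^ k (sin θ, cos θ)` satisfies a
Chebyshev recursion, and `G` is unitary, so the failure probability is `(1 - λ) * D (c * λ) ^ 2`
with `D (sin² β) = cos ((2 * k + 1) * β) / cos β`. The failure curve with ratio `c` vanishes at
`p / c`, where `p = sin² (π / (4 * k + 2))`. Lowering `c` raises the curve to the left of its
zero and lowers it to the right, so two curves cross once, between their zeros, and on the interval
between consecutive crossings the worst failure of the best curve is attained at the left end or
at the right end (at `λ_key` for the last interval).

If these worst values are not all equal, then moving ratios and division points passes the slack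
of one interval on to its neighbours, until the worst failure has dropped on all of them. If they
are all equal to `e`, consider `n` curves which do better, i.e. stay below `e` everywhere. Among
the `n + 1` points consisting of the division points and `λ_key`, two fall to the same curve,
which is impossible: staying below `e` at the left one bounds its ratio strictly from below, and
staying below `e` at the right one bounds it strictly from above by a number which is no larger.
-/

namespace MultiphaseSearch

open Set Filter Topology Polynomial

/-! ### The failure probability -/

/-- The polynomial `D` with `D (sin² β) = cos ((2k + 1) β) / cos β` (a Chebyshev polynomial of the
third kind in `1 - 2 y`). The search fails with probability `(1 - λ) * D (sin² (φ / 2) * λ) ^ 2`. -/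
noncomputable def failPoly (k : ℕ) (y : ℝ) : ℝ :=
  (Chebyshev.U ℝ k - Chebyshev.U ℝ (k - 1)).eval (1 - 2 * y)

theorem continuous_failPoly (k : ℕ) : Continuous (failPoly k) := by
  unfold failPoly
  fun_prop

theorem failPoly_zero (y : ℝ) : failPoly 0 y = 1 := by simp [failPoly]

theorem failPoly_one (y : ℝ) : failPoly 1 y = 1 - 4 * y := by
  simp only [failPoly, Nat.cast_one, sub_self, Chebyshev.U_one, Chebyshev.U_zero, eval_sub,
    eval_mul, eval_ofNat, eval_X, eval_one]
  ring

theorem failPoly_add_two (k : ℕ) (y : ℝ) :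
    failPoly (k + 2) y = 2 * (1 - 2 * y) * failPoly (k + 1) y - failPoly k y := by
  have h1 := Chebyshev.U_add_two ℝ k
  have h0 := Chebyshev.U_add_two ℝ (k - 1)
  have e : (k : ℤ) - 1 + 2 = k + 2 - 1 := by ring
  have e' : (k : ℤ) + 1 - 1 = k - 1 + 1 := by ring
  rw [e] at h0
  simp only [failPoly, Nat.cast_add, Nat.cast_ofNat, Nat.cast_one, h1, h0, e', eval_sub, eval_mul,
    eval_ofNat, eval_X, sub_add_cancel]
  ring

theorem cos_mul_failPoly_sin_sq (k : ℕ) (β : ℝ) :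
    Real.cos β * failPoly k (Real.sin β ^ 2) = Real.cos ((2 * k + 1) * β) := by
  induction k using Nat.twoStepInduction with
  | zero => simp [failPoly_zero]
  | one =>
    rw [failPoly_one, Nat.cast_one, show (2 * 1 + 1 : ℝ) * β = 3 * β by ring, Real.cos_three_mul,
      Real.sin_sq]
    ring
  | more k h0 h1 =>
    have hsum := Real.two_mul_cos_mul_cos ((2 * (k + 1 : ℕ) + 1) * β) (2 * β)
    rw [Real.cos_two_mul, Real.cos_sq',
      show (2 * (k + 1 : ℕ) + 1) * β - 2 * β = (2 * k + 1) * β by push_cast; ring,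
      show (2 * (k + 1 : ℕ) + 1) * β + 2 * β = (2 * (k + 2 : ℕ) + 1) * β by push_cast; ring] at hsum
    rw [failPoly_add_two]
    linear_combination 2 * (1 - 2 * Real.sin β ^ 2) * h1 - h0 + hsum

theorem failPoly_sin_sq (k : ℕ) {β : ℝ} (h : Real.cos β ≠ 0) :
    failPoly k (Real.sin β ^ 2) = Real.cos ((2 * k + 1) * β) / Real.cos β := by
  rw [eq_div_iff h, mul_comm, cos_mul_failPoly_sin_sq]

/-- The parameter `sin² (φ / 2) ∈ [0, 1]` through which the phase `φ` enters the success
probability. -/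
noncomputable def phaseRatio (φ : ℝ) : ℝ := (1 - Real.cos φ) / 2

theorem exp_sq_add_one (φ : ℝ) : Complex.exp (Complex.I * φ) ^ 2 + 1 =
    2 * Complex.exp (Complex.I * φ) * (1 - 2 * phaseRatio φ : ℝ) := by
  have hinv : Complex.exp (φ * Complex.I) * Complex.exp (-φ * Complex.I) = 1 := by
    rw [← Complex.exp_add]; simp
  rw [phaseRatio, mul_div_cancel₀ _ two_ne_zero, sub_sub_cancel, Complex.ofReal_cos, Complex.cos,
    mul_comm Complex.I]
  linear_combination -hinv

theorem sin_sq_add_cos_sq_ofReal (θ : ℝ) : (Real.sin θ : ℂ) ^ 2 + (Real.cos θ : ℂ) ^ 2 = 1 := by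
  exact_mod_cast Real.sin_sq_add_cos_sq θ

theorem trace_groverMatrix (φ θ : ℝ) : (groverMatrix φ θ).trace =
    -2 * Complex.exp (Complex.I * φ) * (1 - 2 * (phaseRatio φ * Real.sin θ ^ 2) : ℝ) := by
  have hsc := sin_sq_add_cos_sq_ofReal θ
  have he := exp_sq_add_one φ
  rw [groverMatrix, Matrix.trace_fin_two_of]
  push_cast at he hsc ⊢
  linear_combination -2 * Complex.exp (Complex.I * φ) * hsc - Complex.sin θ ^ 2 * he

theorem det_groverMatrix (φ θ : ℝ) :
    (groverMatrix φ θ).det = Complex.exp (Complex.I * φ) ^ 2 := by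
  have hsc := sin_sq_add_cos_sq_ofReal θ
  rw [groverMatrix, Matrix.det_fin_two_of]
  linear_combination Complex.exp (Complex.I * φ) ^ 2 *
    ((Real.sin θ : ℂ) ^ 2 + (Real.cos θ : ℂ) ^ 2 + 1) * hsc

theorem sq_eq_trace_smul_sub_det_smul {R : Type*} [CommRing R] (A : Matrix (Fin 2) (Fin 2) R) :
    A ^ 2 = A.trace • A - A.det • 1 := by
  rw [← sub_eq_zero]
  nontriviality R
  have h := A.aeval_self_charpoly
  simp only [Matrix.charpoly_fin_two, map_add, map_sub, map_mul, map_pow, aeval_X, aeval_C,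
    Algebra.algebraMap_eq_smul_one, smul_one_mul] at h
  rw [← h]
  abel

theorem mulVec_groverMatrix_pow_one (φ θ : ℝ) (k : ℕ) :
    ((groverMatrix φ θ) ^ k).mulVec (initialState θ) 1 =
      (-Complex.exp (Complex.I * φ)) ^ k * Real.cos θ *
        failPoly k (phaseRatio φ * Real.sin θ ^ 2) := by
  induction k using Nat.twoStepInduction with
  | zero => simp [initialState, failPoly_zero]
  | one =>
    have hsc := sin_sq_add_cos_sq_ofReal θ
    have he := exp_sq_add_one φ
    simp only [groverMatrix, initialState, failPoly_one, Matrix.mulVec_cons, pow_one]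
    simp only [neg_mul, Matrix.mulVec_empty, add_zero, Pi.add_apply, Pi.smul_apply,
      Function.comp_apply, Matrix.cons_val_one, Matrix.cons_val_fin_one, Matrix.head_cons,
      smul_eq_mul, Matrix.tail_cons]
    push_cast
    push_cast at he hsc
    linear_combination (-Complex.exp (Complex.I * φ) * Complex.cos θ) * hsc -
      Complex.cos θ * Complex.sin θ ^ 2 * he
  | more k h0 h1 =>
    rw [pow_add, sq_eq_trace_smul_sub_det_smul, mul_sub, mul_smul_comm, mul_smul_comm, mul_one,
      ← pow_succ, Matrix.sub_mulVec, Matrix.smul_mulVec, Matrix.smul_mulVec, Pi.sub_apply,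
      Pi.smul_apply, Pi.smul_apply, h1, h0, failPoly_add_two, trace_groverMatrix, det_groverMatrix]
    simp only [smul_eq_mul]
    push_cast
    ring

theorem groverMatrix_mem_unitaryGroup (φ θ : ℝ) :
    groverMatrix φ θ ∈ Matrix.unitaryGroup (Fin 2) ℂ := by
  have hsc := sin_sq_add_cos_sq_ofReal θ
  have he : (starRingEnd ℂ) (Complex.exp (Complex.I * φ)) * Complex.exp (Complex.I * φ) = 1 := by
    rw [← Complex.normSq_eq_conj_mul_self, Complex.normSq_eq_norm_sq,
      Complex.norm_exp_I_mul_ofReal, one_pow, Complex.ofReal_one]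
  rw [Matrix.mem_unitaryGroup_iff', groverMatrix, Matrix.star_eq_conjTranspose]
  ext i j
  fin_cases i <;> fin_cases j <;>
    simp only [Matrix.mul_apply, Matrix.conjTranspose_apply, Fin.sum_univ_two, Matrix.of_apply,
      Matrix.cons_val_zero, Matrix.cons_val_one, Matrix.cons_val', Matrix.cons_val_fin_one,
      Matrix.one_apply, Fin.zero_eta, Fin.mk_one, Fin.isValue, Complex.star_def, map_add,
      map_sub, map_mul, map_neg, map_pow, map_one, Complex.conj_ofReal, if_true, one_ne_zero,
      zero_ne_one, if_false] <;>
    generalize (starRingEnd ℂ) (Complex.exp (Complex.I * φ)) = e' at he ⊢ <;>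
    generalize Complex.exp (Complex.I * φ) = e at he ⊢ <;>
    generalize (Real.sin θ : ℂ) = s at hsc ⊢ <;>
    generalize (Real.cos θ : ℂ) = c at hsc ⊢ <;>
    grind

theorem sum_normSq_mulVec_of_mem_unitaryGroup {ι : Type*} [Fintype ι] [DecidableEq ι]
    {A : Matrix ι ι ℂ} (hA : A ∈ Matrix.unitaryGroup ι ℂ) (v : ι → ℂ) :
    ∑ i, Complex.normSq (A.mulVec v i) = ∑ i, Complex.normSq (v i) := by
  have hdot (w : ι → ℂ) : ((∑ i, Complex.normSq (w i) : ℝ) : ℂ) = star w ⬝ᵥ w := by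
    simp [dotProduct, Complex.normSq_eq_conj_mul_self]
  apply Complex.ofReal_injective
  rw [hdot, hdot, Matrix.star_mulVec, Matrix.dotProduct_mulVec, Matrix.vecMul_vecMul,
    ← Matrix.star_eq_conjTranspose, Matrix.mem_unitaryGroup_iff'.1 hA, Matrix.vecMul_one]

/-- The probability `(1 - l) * D (c * l) ^ 2` that a search with phase ratio `c` fails when the
fraction of targets is `l`, for `D = failPoly k` and, in the abstract part of the argument, for any
function `D` with the properties listed in `FailureProfile`. -/
def failure (D : ℝ → ℝ) (c l : ℝ) : ℝ := (1 - l) * D (c * l) ^ 2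

theorem successProb_eq_one_sub_failure (k : ℕ) (φ : ℝ) {l : ℝ} (hl : l ∈ Icc (0 : ℝ) 1) :
    successProb k φ l = 1 - failure (failPoly k) (phaseRatio φ) l := by
  set θ := Real.arcsin (Real.sqrt l)
  have hsin : Real.sin θ ^ 2 = l := by
    rw [Real.sin_arcsin (by linarith [Real.sqrt_nonneg l]) (Real.sqrt_le_one.2 hl.2),
      Real.sq_sqrt hl.1]
  have hcos : Real.cos θ ^ 2 = 1 - l := by rw [Real.cos_sq', hsin]
  have hnorm := sum_normSq_mulVec_of_mem_unitaryGroup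
    (pow_mem (groverMatrix_mem_unitaryGroup φ θ) k) (initialState θ)
  have hinit : ∑ i, Complex.normSq (initialState θ i) = 1 := by
    simp only [initialState, Fin.sum_univ_two, Matrix.cons_val_zero, Matrix.cons_val_one,
      Complex.normSq_ofReal, ← pow_two, Real.sin_sq_add_cos_sq]
  have hexp : Complex.normSq (Complex.exp (Complex.I * φ)) = 1 := by
    rw [Complex.normSq_eq_norm_sq, Complex.norm_exp_I_mul_ofReal, one_pow]
  simp only [hinit, Fin.sum_univ_two, mulVec_groverMatrix_pow_one, map_mul, map_pow,
    Complex.normSq_neg, Complex.normSq_ofReal, hexp, one_pow, one_mul, ← pow_two, hsin,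
    hcos] at hnorm
  exact eq_sub_of_add_eq hnorm

/-! ### Failure profiles -/

/-- The properties of the failure curves on `[p, q]` on which the optimality criterion rests. Here
`D` decreases through its zero `p`, so the curve with ratio `c` vanishes at `p / c`, and `K c`
is the point at which it is largest beyond that zero. Two curves cross where their values of `D` are
opposite; by `cross_lt_key`, the one with the larger ratio is not past its maximum there. -/
structure FailureProfile (p q : ℝ) (D K : ℝ → ℝ) : Prop where
  pos : 0 < p
  lt : p < q
  le_one : q ≤ 1
  cont : Continuous D
  anti : StrictAntiOn D (Icc 0 q)
  zero : D p = 0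
  key_gt : ∀ c ∈ Ioc (p / q) 1, p < c * K c
  key_le : ∀ c ∈ Ioc (p / q) 1, K c ≤ q
  key_lt_one : ∀ c ∈ Ioc (p / q) 1, K c < 1
  key_cont : ∀ c ∈ Ioc (p / q) 1, ContinuousAt K c
  mono : ∀ c ∈ Ioc (p / q) 1, ∀ l l', p ≤ c * l → l < l' → l' ≤ K c →
    failure D c l < failure D c l'
  le_key : ∀ c ∈ Ioc (p / q) 1, ∀ l, p ≤ c * l → l ≤ q → failure D c l ≤ failure D c (K c)
  cross_lt_key : ∀ c ∈ Ioc (p / q) 1, ∀ c' ∈ Ioc (p / q) 1, c' < c → ∀ l, 0 < l → l < q →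
    D (c * l) + D (c' * l) = 0 → l < K c

theorem failure_nonneg {D : ℝ → ℝ} {c l : ℝ} (hl : l ≤ 1) : 0 ≤ failure D c l :=
  mul_nonneg (by linarith) (sq_nonneg _)

namespace FailureProfile

variable {p q c c' l : ℝ} {D K : ℝ → ℝ}

theorem ratio_pos (F : FailureProfile p q D K) (hc : p / q < c) : 0 < c :=
  (div_pos F.pos (F.pos.trans F.lt)).trans hc

theorem lt_mul (F : FailureProfile p q D K) (hc : p / q < c) : p < c * q := by
  rwa [div_lt_iff₀ (F.pos.trans F.lt)] at hc

theorem mul_mem (F : FailureProfile p q D K) (hc : c ∈ Ioc (p / q) 1) (hl : l ∈ Icc 0 q) :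
    c * l ∈ Icc 0 q :=
  ⟨mul_nonneg (F.ratio_pos hc.1).le hl.1, (mul_le_of_le_one_left hl.1 hc.2).trans hl.2⟩

theorem key_mem_Icc (F : FailureProfile p q D K) (hc : c ∈ Ioc (p / q) 1) : K c ∈ Icc p q :=
  ⟨by nlinarith [F.key_gt c hc, F.pos, hc.2, F.ratio_pos hc.1], F.key_le c hc⟩

theorem nonneg_of_le (F : FailureProfile p q D K) {y : ℝ} (h0 : 0 ≤ y) (h : y ≤ p) : 0 ≤ D y :=
  F.zero.ge.trans (F.anti.antitoneOn ⟨h0, h.trans F.lt.le⟩ ⟨F.pos.le, F.lt.le⟩ h)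

theorem nonpos_of_ge (F : FailureProfile p q D K) {y : ℝ} (h : p ≤ y) (hq : y ≤ q) : D y ≤ 0 :=
  (F.anti.antitoneOn ⟨F.pos.le, F.lt.le⟩ ⟨F.pos.le.trans h, hq⟩ h).trans F.zero.le

theorem sq_lt_of_le_zero (F : FailureProfile p q D K) {x y : ℝ} (h0 : 0 ≤ x) (hxy : x < y)
    (hy : y ≤ p) : D y ^ 2 < D x ^ 2 :=
  pow_lt_pow_left₀ (F.anti ⟨h0, (hxy.le.trans hy).trans F.lt.le⟩
    ⟨h0.trans hxy.le, hy.trans F.lt.le⟩ hxy) (F.nonneg_of_le (h0.trans hxy.le) hy) two_ne_zero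

theorem sq_lt_of_ge_zero (F : FailureProfile p q D K) {x y : ℝ} (hx : p ≤ x) (hxy : x < y)
    (hy : y ≤ q) : D x ^ 2 < D y ^ 2 := by
  have h0 : 0 ≤ x := F.pos.le.trans hx
  have h := F.anti ⟨h0, hxy.le.trans hy⟩ ⟨h0.trans hxy.le, hy⟩ hxy
  nlinarith [F.nonpos_of_ge hx (hxy.le.trans hy)]

theorem failure_lt_left (F : FailureProfile p q D K) (hc : 0 ≤ c) (hl : 0 < l) (hl1 : l < 1)
    (h : c < c') (hp : c' * l ≤ p) : failure D c' l < failure D c l :=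
  mul_lt_mul_of_pos_left (F.sq_lt_of_le_zero (by positivity) (by gcongr) hp) (by linarith)

theorem failure_lt_right (F : FailureProfile p q D K) (hl : 0 < l) (hl1 : l < 1) (h : c < c')
    (hp : p ≤ c * l) (hq : c' * l ≤ q) : failure D c l < failure D c' l :=
  mul_lt_mul_of_pos_left (F.sq_lt_of_ge_zero hp (by gcongr) hq) (by linarith)

theorem failure_lt_of_lt (F : FailureProfile p q D K) {l' : ℝ} (hc : 0 < c) (hl : 0 ≤ l)
    (hl1 : l' < 1) (h : l < l') (hp : c * l' ≤ p) : failure D c l' < failure D c l :=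
  mul_lt_mul'' (by linarith) (F.sq_lt_of_le_zero (by positivity) (by gcongr) hp) (by linarith)
    (sq_nonneg _)

theorem failure_eq_zero (F : FailureProfile p q D K) (h : c * l = p) : failure D c l = 0 := by
  rw [failure, h, F.zero, zero_pow two_ne_zero, mul_zero]

theorem failure_eq_iff (F : FailureProfile p q D K) (hc : c ∈ Ioc (p / q) 1)
    (hc' : c' ∈ Ioc (p / q) 1) (h : c' < c) (hl : l ∈ Ico p q) :
    failure D c l = failure D c' l ↔ D (c * l) + D (c' * l) = 0 := by
  have hl0 : 0 < l := F.pos.trans_le hl.1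
  have hlt := F.anti (F.mul_mem hc' ⟨hl0.le, hl.2.le⟩) (F.mul_mem hc ⟨hl0.le, hl.2.le⟩)
    (mul_lt_mul_of_pos_right h hl0)
  rw [failure, failure, mul_right_inj' (by linarith [hl.2, F.le_one]), sq_eq_sq_iff_eq_or_eq_neg,
    or_iff_right hlt.ne, eq_neg_iff_add_eq_zero]

theorem existsUnique_failure_eq (F : FailureProfile p q D K) (hc : c ∈ Ioc (p / q) 1)
    (hc' : c' ∈ Ioc (p / q) 1) (h : c' < c) :
    ∃! l, l ∈ Ico p q ∧ failure D c l = failure D c' l := by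
  have hmem {l : ℝ} (hl : l ∈ Icc p q) : l ∈ Icc 0 q := ⟨F.pos.le.trans hl.1, hl.2⟩
  have hanti : StrictAntiOn (fun l => D (c * l) + D (c' * l)) (Icc p q) := fun x hx y hy hxy =>
    add_lt_add
      (F.anti (F.mul_mem hc (hmem hx)) (F.mul_mem hc (hmem hy))
        (mul_lt_mul_of_pos_left hxy (F.ratio_pos hc.1)))
      (F.anti (F.mul_mem hc' (hmem hx)) (F.mul_mem hc' (hmem hy))
        (mul_lt_mul_of_pos_left hxy (F.ratio_pos hc'.1)))
  have hcont : ContinuousOn (fun l => D (c * l) + D (c' * l)) (Icc p q) := by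
    have := F.cont
    fun_prop
  have hp_mem : p ∈ Icc 0 q := ⟨F.pos.le, F.lt.le⟩
  have hq_mem : q ∈ Icc 0 q := ⟨F.pos.le.trans F.lt.le, le_rfl⟩
  have hp : 0 < D (c * p) + D (c' * p) := by
    refine add_pos_of_nonneg_of_pos (F.nonneg_of_le (F.mul_mem hc hp_mem).1
      (mul_le_of_le_one_left F.pos.le hc.2)) ?_
    rw [← F.zero]
    exact F.anti (F.mul_mem hc' hp_mem) hp_mem (mul_lt_of_lt_one_left F.pos (h.trans_le hc.2))
  have hq : D (c * q) + D (c' * q) < 0 := by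
    refine add_neg ?_ ?_ <;> rw [← F.zero]
    · exact F.anti hp_mem (F.mul_mem hc hq_mem) (F.lt_mul hc.1)
    · exact F.anti hp_mem (F.mul_mem hc' hq_mem) (F.lt_mul hc'.1)
  obtain ⟨l, hl, hl0⟩ := intermediate_value_Icc' F.lt.le hcont ⟨hq.le, hp.le⟩
  have hlq : l < q := hl.2.lt_of_ne (by rintro rfl; exact hq.ne hl0)
  refine ⟨l, ⟨⟨hl.1, hlq⟩, (F.failure_eq_iff hc hc' h ⟨hl.1, hlq⟩).2 hl0⟩, ?_⟩
  rintro y ⟨hy, hy'⟩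
  exact hanti.injOn ⟨hy.1, hy.2.le⟩ hl (((F.failure_eq_iff hc hc' h hy).1 hy').trans hl0.symm)

theorem zeros_separate_of_failure_eq (F : FailureProfile p q D K) (hc : c ∈ Ioc (p / q) 1)
    (hc' : c' ∈ Ioc (p / q) 1) (h : c' < c) (hl : l ∈ Ico p q)
    (he : failure D c l = failure D c' l) : p < c * l ∧ c' * l < p := by
  have hl0 : 0 < l := F.pos.trans_le hl.1
  have hl1 : l < 1 := hl.2.trans_le F.le_one
  constructor <;> by_contra! hn
  · exact (F.failure_lt_left (F.ratio_pos hc'.1).le hl0 hl1 h hn).ne he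
  · exact (F.failure_lt_right hl0 hl1 h hn (F.mul_mem hc ⟨hl0.le, hl.2.le⟩).2).ne' he

theorem min_key_mem (F : FailureProfile p q D K) {v : ℝ} (hc : c ∈ Ioc (p / q) 1)
    (hv : p < c * v) : p < min v (K c) ∧ p < c * min v (K c) := by
  have hmul : p < c * min v (K c) := by
    rcases min_choice v (K c) with h | h <;> rw [h]
    exacts [hv, F.key_gt c hc]
  have h0 : 0 < min v (K c) := pos_of_mul_pos_right (F.pos.trans hmul) (F.ratio_pos hc.1).le
  exact ⟨hmul.trans_le (mul_le_of_le_one_left h0.le hc.2), hmul⟩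

theorem failure_le_failure_min_key (F : FailureProfile p q D K) {v : ℝ} (hc : c ∈ Ioc (p / q) 1)
    (hp : p ≤ c * l) (hlv : l ≤ v) (hv : v ≤ q) :
    failure D c l ≤ failure D c (min v (K c)) := by
  rcases le_or_gt l (K c) with hl | hl
  · rcases (le_min hlv hl).eq_or_lt with h | h
    · rw [← h]
    · exact (F.mono c hc _ _ hp h (min_le_right _ _)).le
  · rw [min_eq_right (hl.le.trans hlv)]
    exact F.le_key c hc l hp (hlv.trans hv)

theorem failure_min_key_lt (F : FailureProfile p q D K) {v : ℝ} (hc : c ∈ Ioc (p / q) 1)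
    (hc' : c' ∈ Ioc (p / q) 1) (h : c < c') (hp : p < c * v) (hv : v ≤ q) :
    failure D c (min v (K c)) < failure D c' (min v (K c')) := by
  obtain ⟨hl, hcl⟩ := F.min_key_mem hc hp
  have hl0 := F.pos.trans hl
  refine (F.failure_lt_right hl0 ((min_le_right _ _).trans_lt (F.key_lt_one c hc)) h hcl.le
    (F.mul_mem hc' ⟨hl0.le, (min_le_left _ _).trans hv⟩).2).trans_le
    (F.failure_le_failure_min_key hc' (hcl.le.trans ?_) (min_le_left _ _) hv)
  gcongr

theorem continuousAt_failure_min_key (F : FailureProfile p q D K) (v : ℝ)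
    (hc : c ∈ Ioc (p / q) 1) : ContinuousAt (fun x => failure D x (min v (K x))) c := by
  have hK := F.key_cont c hc
  have hD := F.cont
  unfold failure
  fun_prop

end FailureProfile

/-! ### Spanned intervals -/

theorem exists_chain_of_step {α : Type*} {L S : α → α → Prop} (hSL : ∀ u v, S u v → L u v)
    (hstep : ∀ u v t, L u v → L v t → S u v ∨ S v t → ∃ x, S u x ∧ S x t) {n : ℕ} {w : ℕ → α}
    (hw : ∀ i < n, L (w i) (w (i + 1))) (hS : ∃ i < n, S (w i) (w (i + 1))) :
    ∃ w' : ℕ → α, w' 0 = w 0 ∧ w' n = w n ∧ ∀ i < n, S (w' i) (w' (i + 1)) := by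
  induction n generalizing w with
  | zero => simp at hS
  | succ n ih =>
    have of_lt {w : ℕ → α} (hw : ∀ i < n + 1, L (w i) (w (i + 1)))
        (hS : ∃ i < n, S (w i) (w (i + 1))) : ∃ w' : ℕ → α,
          w' 0 = w 0 ∧ w' (n + 1) = w (n + 1) ∧ ∀ i < n + 1, S (w' i) (w' (i + 1)) := by
      obtain ⟨w', h0, hn, hw'⟩ := ih (fun i hi => hw i (by omega)) hS
      obtain ⟨j, rfl⟩ : ∃ j, n = j + 1 := ⟨n - 1, by grind⟩
      obtain ⟨x, hx, hx'⟩ := hstep (w' j) (w' (j + 1)) (w (j + 2)) (hSL _ _ (hw' j (by omega)))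
        (hn ▸ hw (j + 1) (by omega)) (.inl (hw' j (by omega)))
      refine ⟨fun i => if i ≤ j then w' i else if i = j + 1 then x else w i, by grind, by grind,
        fun i hi => ?_⟩
      grind
    obtain ⟨i, hi, hSi⟩ := hS
    rcases (Nat.lt_succ_iff.1 hi).lt_or_eq with hi | rfl
    · exact of_lt hw ⟨i, hi, hSi⟩
    rcases i with _ | j
    · exact ⟨w, rfl, rfl, by grind⟩
    obtain ⟨x, hx, hx'⟩ := hstep _ _ _ (hw j (by omega)) (hw (j + 1) hi) (.inr hSi)
    obtain ⟨w', h0, hn, hw'⟩ := of_lt (w := Function.update w (j + 1) x)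
      (fun i hi => by grind) ⟨j, by omega, by grind⟩
    exact ⟨w', by grind, by grind, hw'⟩

theorem exists_mem_Icc_succ {α : Type*} [LinearOrder α] {n : ℕ} {b : ℕ → α} {l : α} (hn : 0 < n)
    (h0 : b 0 ≤ l) (hl : l ≤ b n) : ∃ m < n, l ∈ Icc (b m) (b (m + 1)) := by
  induction n, hn using Nat.le_induction with
  | base => exact ⟨0, one_pos, h0, hl⟩
  | succ n _ ih =>
    rcases le_total l (b n) with h | h
    · obtain ⟨m, hm, hml⟩ := ih h
      exact ⟨m, by omega, hml⟩
    · exact ⟨n, by omega, h, hl⟩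

/-- The curve with ratio `c` spans `[u, v]`: it vanishes in `[u, v]`, and `v` comes before its
maximum, unless `v` is the last point `q`. -/
structure Spans (p q : ℝ) (K : ℝ → ℝ) (c u v : ℝ) : Prop where
  lt_ratio : p / q < c
  le_left : p ≤ u
  mul_left_le : c * u ≤ p
  lt_mul_right : p < c * v
  right : v < K c ∨ v = q

/-- The largest failure on `[u, v]` of the curve with ratio `c`, provided that it spans `[u, v]`. -/
def worst (D K : ℝ → ℝ) (c u v : ℝ) : ℝ := max (failure D c u) (failure D c (min v (K c)))

namespace FailureProfile

variable {p q c c' u v x t V : ℝ} {D K : ℝ → ℝ}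

theorem ratio_mem (F : FailureProfile p q D K) (h : Spans p q K c u v) : c ∈ Ioc (p / q) 1 :=
  ⟨h.lt_ratio, le_of_mul_le_mul_right
    (h.mul_left_le.trans (h.le_left.trans (one_mul u).ge)) (F.pos.trans_le h.le_left)⟩

theorem right_le (F : FailureProfile p q D K) (h : Spans p q K c u v) : v ≤ q :=
  h.right.elim (fun hv => hv.le.trans (F.key_le c (F.ratio_mem h))) le_of_eq

theorem left_lt_one (F : FailureProfile p q D K) (h : Spans p q K c u v) : u < 1 :=
  (lt_of_mul_lt_mul_left (h.mul_left_le.trans_lt (F.lt_mul h.lt_ratio))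
    (F.ratio_pos h.lt_ratio).le).trans_le F.le_one

theorem failure_le_worst (F : FailureProfile p q D K) (h : Spans p q K c u v) {l : ℝ}
    (hl : l ∈ Icc u v) : failure D c l ≤ worst D K c u v := by
  rcases le_or_gt p (c * l) with hp | hp
  · exact (F.failure_le_failure_min_key (F.ratio_mem h) hp hl.2 (F.right_le h)).trans
      (le_max_right _ _)
  · rcases hl.1.eq_or_lt with rfl | hul
    · exact le_max_left _ _
    · have hc := F.ratio_pos h.lt_ratio
      have hlq : l < q := lt_of_mul_lt_mul_left (hp.trans (F.lt_mul h.lt_ratio)) hc.le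
      exact (F.failure_lt_of_lt hc (F.pos.le.trans h.le_left) (hlq.trans_le F.le_one) hul
        hp.le).le.trans (le_max_left _ _)

theorem right_lt_key (F : FailureProfile p q D K) (h : Spans p q K c u v)
    (h' : Spans p q K c' v t) : v < K c := by
  refine h.right.resolve_right ?_
  rintro rfl
  exact (h'.mul_left_le.trans_lt (F.lt_mul h'.lt_ratio)).false

/-- Where two spanned intervals meet, the left curve increases and the right one decreases, so
slack in one of them is shared by moving the common end point. -/
theorem exists_point_lt (F : FailureProfile p q D K) (h : Spans p q K c u v)
    (h' : Spans p q K c' v t) (hV : failure D c v ≤ V) (hV' : failure D c' v ≤ V)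
    (hlt : failure D c v < V ∨ failure D c' v < V) :
    ∃ x, Spans p q K c u x ∧ Spans p q K c' x t ∧ failure D c x < V ∧ failure D c' x < V := by
  have hcont (d : ℝ) : Continuous (failure D d) := by
    have := F.cont
    unfold failure
    fun_prop
  have hK := F.right_lt_key h h'
  have hc := F.ratio_mem h
  have hv0 := F.pos.trans_le h'.le_left
  have hright : ∀ᶠ x in 𝓝 v, p < c * x ∧ x < K c :=
    ((continuousAt_const.mul continuousAt_id).eventually_const_lt h.lt_mul_right).and
      (eventually_lt_nhds hK)
  rcases hlt with hlt | hlt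
  · rcases h'.mul_left_le.eq_or_lt with hz | hz
    · refine ⟨v, h, h', hlt, ?_⟩
      rw [F.failure_eq_zero hz]
      exact (failure_nonneg ((hK.trans (F.key_lt_one c hc)).le)).trans_lt hlt
    · obtain ⟨x, ⟨⟨hx, hxK⟩, hxp, hxV⟩, hvx⟩ := ((hright.and
        (((continuousAt_const.mul continuousAt_id).eventually_lt_const hz).and
          ((hcont c).continuousAt.eventually_lt_const hlt))).filter_mono
          nhdsWithin_le_nhds |>.and (self_mem_nhdsWithin (s := Ioi v))).exists
      exact ⟨x, ⟨h.lt_ratio, h.le_left, h.mul_left_le, hx, .inl hxK⟩,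
        ⟨h'.lt_ratio, h'.le_left.trans (le_of_lt hvx), hxp.le, h'.lt_mul_right, h'.right⟩, hxV,
        (F.failure_lt_of_lt (F.ratio_pos h'.lt_ratio) hv0.le (hxK.trans (F.key_lt_one c hc)) hvx
          hxp.le).trans_le hV'⟩
  · obtain ⟨x, ⟨⟨hx, hxK⟩, hxV⟩, hxv⟩ := ((hright.and
      ((hcont c').continuousAt.eventually_lt_const hlt)).filter_mono
        nhdsWithin_le_nhds |>.and (self_mem_nhdsWithin (s := Iio v))).exists
    have hc'0 := F.ratio_pos h'.lt_ratio
    have hx0 : 0 < x := pos_of_mul_pos_right (F.pos.trans hx) (F.ratio_pos hc.1).le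
    exact ⟨x, ⟨h.lt_ratio, h.le_left, h.mul_left_le, hx, .inl hxK⟩,
      ⟨h'.lt_ratio, hx.le.trans (mul_le_of_le_one_left hx0.le hc.2),
        (mul_le_mul_of_nonneg_left (le_of_lt hxv) hc'0.le).trans h'.mul_left_le, h'.lt_mul_right,
        h'.right⟩, (F.mono c hc x v hx.le hxv hK.le).trans_le hV, hxV⟩

theorem eventually_spans_iff (F : FailureProfile p q D K) (h : Spans p q K c u v) :
    ∀ᶠ x in 𝓝 c, Spans p q K x u v ↔ x * u ≤ p := by
  have hK : ∀ᶠ x in 𝓝 c, v < K x ∨ v = q := h.right.elim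
    (fun hv => ((F.key_cont c (F.ratio_mem h)).eventually_const_lt hv).mono fun _ => .inl)
    fun hv => .of_forall fun _ => .inr hv
  filter_upwards [eventually_gt_nhds h.lt_ratio, hK,
    (continuousAt_id.mul continuousAt_const).eventually_const_lt h.lt_mul_right] with x hx hxK hxv
  exact ⟨fun hs => hs.mul_left_le, fun hp => ⟨hx, h.le_left, hp, hxv, hxK⟩⟩

/-- Increasing the ratio lowers the curve at `u` and raises its maximum, so slack in one of them
is shared by moving the ratio. -/
theorem exists_worst_lt (F : FailureProfile p q D K) (h : Spans p q K c u v)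
    (hV : worst D K c u v ≤ V)
    (hlt : failure D c u < V ∨ failure D c (min v (K c)) < V) :
    ∃ x, Spans p q K x u v ∧ worst D K x u v < V := by
  obtain ⟨hVu, hVv⟩ := max_le_iff.1 hV
  have hc := F.ratio_mem h
  have hu0 := F.pos.trans_le h.le_left
  have hcontu : Continuous fun x => failure D x u := by
    have := F.cont
    unfold failure
    fun_prop
  rcases hlt with hlt | hlt
  · obtain ⟨x, ⟨hspans, hxV⟩, hxc⟩ := (((F.eventually_spans_iff h).and
      (hcontu.continuousAt.eventually_lt_const hlt)).filter_mono nhdsWithin_le_nhds |>.and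
        (self_mem_nhdsWithin (s := Iio c))).exists
    have hx : Spans p q K x u v :=
      hspans.2 ((mul_le_mul_of_nonneg_right (le_of_lt hxc) hu0.le).trans h.mul_left_le)
    exact ⟨x, hx, max_lt hxV ((F.failure_min_key_lt (F.ratio_mem hx) hc hxc hx.lt_mul_right
      (F.right_le h)).trans_le hVv)⟩
  · rcases h.mul_left_le.eq_or_lt with hz | hz
    · refine ⟨c, h, max_lt ?_ hlt⟩
      rw [F.failure_eq_zero hz]
      exact (failure_nonneg ((min_le_right _ _).trans (F.key_lt_one c hc).le)).trans_lt hlt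
    · obtain ⟨x, ⟨hspans, hxV, hxu⟩, hcx⟩ := (((F.eventually_spans_iff h).and
        (((F.continuousAt_failure_min_key v hc).eventually_lt_const hlt).and
          ((continuousAt_id.mul continuousAt_const).eventually_lt_const hz))).filter_mono
            nhdsWithin_le_nhds |>.and (self_mem_nhdsWithin (s := Ioi c))).exists
      exact ⟨x, hspans.2 hxu.le, max_lt ((F.failure_lt_left (F.ratio_pos hc.1).le hu0
        (F.left_lt_one h) hcx hxu.le).trans_le hVu) hxV⟩

theorem exists_point_worst_lt (F : FailureProfile p q D K) (h : Spans p q K c u v)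
    (h' : Spans p q K c' v t) (hV : worst D K c u v ≤ V) (hV' : worst D K c' v t ≤ V)
    (hlt : worst D K c u v < V ∨ worst D K c' v t < V) :
    ∃ x, (∃ d, Spans p q K d u x ∧ worst D K d u x < V) ∧
      ∃ d, Spans p q K d x t ∧ worst D K d x t < V := by
  have hmin {y : ℝ} (hy : Spans p q K c u y) (hy' : Spans p q K c' y t) : min y (K c) = y :=
    min_eq_left (F.right_lt_key hy hy').le
  have hworst {y : ℝ} (hy : Spans p q K c u y) (hy' : Spans p q K c' y t) :
      worst D K c u y = max (failure D c u) (failure D c y) := by rw [worst, hmin hy hy']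
  rw [hworst h h'] at hV hlt
  obtain ⟨hVu, hVv⟩ := max_le_iff.1 hV
  obtain ⟨hVv', hVt⟩ := max_le_iff.1 hV'
  obtain ⟨x, hx, hx', hxV, hxV'⟩ := F.exists_point_lt h h' hVv hVv'
    (hlt.imp (le_max_right _ _).trans_lt (le_max_left _ _).trans_lt)
  refine ⟨x, F.exists_worst_lt hx ?_ (.inr ?_), F.exists_worst_lt hx' ?_ (.inl hxV')⟩
  · rw [hworst hx hx']
    exact max_le hVu hxV.le
  · rwa [hmin hx hx']
  · exact max_le hxV'.le hVt

end FailureProfile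

/-! ### Spanning tuples of ratios -/

/-- Admissibility, with the lower bound `p / q`, of the ratios `c 1 > ⋯ > c n` of `n` phases. -/
def AdmissibleRatios (p q : ℝ) (n : ℕ) (c : ℕ → ℝ) : Prop :=
  (∀ m ∈ Icc 1 n, c m ∈ Ioc (p / q) 1) ∧ StrictAntiOn c (Icc 1 n)

/-- At every point of `[p, q]` one of the curves with ratios `c 1, …, c n` is at most `v`. -/
def FailsAtMost (D : ℝ → ℝ) (p q : ℝ) (n : ℕ) (c : ℕ → ℝ) (v : ℝ) : Prop :=
  ∀ l ∈ Icc p q, ∃ m ∈ Icc 1 n, failure D (c m) l ≤ v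

/-- The points `p = a 0, …, a n = q` cut `[p, q]` into intervals spanned by the curves with ratios
`c 1, …, c n`. -/
structure IsSpanning (p q : ℝ) (K : ℝ → ℝ) (n : ℕ) (c a : ℕ → ℝ) : Prop where
  left : a 0 = p
  right : a n = q
  spans : ∀ m < n, Spans p q K (c (m + 1)) (a m) (a (m + 1))

theorem IsSpanning.strictAntiOn {p q : ℝ} {K : ℝ → ℝ} {n : ℕ} {c a : ℕ → ℝ} (hp : 0 < p)
    (h : IsSpanning p q K n c a) : StrictAntiOn c (Icc 1 n) := by
  refine strictAntiOn_of_add_one_lt ordConnected_Icc fun m _ hm hm' => ?_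
  obtain ⟨j, rfl⟩ : ∃ j, m = j + 1 := ⟨m - 1, by grind⟩
  have hs := h.spans (j + 1) hm'.2
  exact lt_of_mul_lt_mul_right (hs.mul_left_le.trans_lt (h.spans j hm.2).lt_mul_right)
    (hp.le.trans hs.le_left)

namespace FailureProfile

variable {p q v : ℝ} {D K : ℝ → ℝ} {n : ℕ} {a c d : ℕ → ℝ}

theorem admissibleRatios (F : FailureProfile p q D K) (h : IsSpanning p q K n c a) :
    AdmissibleRatios p q n c := by
  refine ⟨fun m hm => ?_, h.strictAntiOn F.pos⟩
  obtain ⟨j, rfl⟩ : ∃ j, m = j + 1 := ⟨m - 1, by grind⟩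
  exact F.ratio_mem (h.spans j hm.2)

theorem isSpanning_of_crossings (F : FailureProfile p q D K) (hc : AdmissibleRatios p q n c)
    (h0 : a 0 = p) (hn : a n = q) (ha : ∀ m, 1 ≤ m → m < n →
      a m ∈ Ico p q ∧ failure D (c m) (a m) = failure D (c (m + 1)) (a m)) :
    IsSpanning p q K n c a := by
  have hlt {m : ℕ} (h1 : 1 ≤ m) (h2 : m < n) : c (m + 1) < c m :=
    hc.2 ⟨h1, h2.le⟩ ⟨by omega, h2⟩ (by omega)
  have hsep {m : ℕ} (h1 : 1 ≤ m) (h2 : m < n) : p < c m * a m ∧ c (m + 1) * a m < p :=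
    F.zeros_separate_of_failure_eq (hc.1 m ⟨h1, h2.le⟩) (hc.1 (m + 1) ⟨by omega, h2⟩) (hlt h1 h2)
      (ha m h1 h2).1 (ha m h1 h2).2
  have hkey {m : ℕ} (h1 : 1 ≤ m) (h2 : m < n) : a m < K (c m) := by
    obtain ⟨hmem, he⟩ := ha m h1 h2
    have hcm := hc.1 m ⟨h1, h2.le⟩
    have hcm' := hc.1 (m + 1) ⟨by omega, h2⟩
    exact F.cross_lt_key _ hcm _ hcm' (hlt h1 h2) _ (F.pos.trans_le hmem.1) hmem.2
      ((F.failure_eq_iff hcm hcm' (hlt h1 h2) hmem).1 he)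
  refine ⟨h0, hn, fun m hm => ?_⟩
  have hcm := hc.1 (m + 1) ⟨by omega, hm⟩
  obtain ⟨hleft, hmul⟩ : p ≤ a m ∧ c (m + 1) * a m ≤ p := by
    rcases m.eq_zero_or_pos with rfl | h1
    · exact ⟨h0.ge, by simpa only [h0] using mul_le_of_le_one_left F.pos.le hcm.2⟩
    · exact ⟨(ha m h1 hm).1.1, (hsep h1 hm).2.le⟩
  obtain ⟨hright, hK⟩ :
      p < c (m + 1) * a (m + 1) ∧ (a (m + 1) < K (c (m + 1)) ∨ a (m + 1) = q) := by
    rcases (Nat.succ_le_iff.2 hm).eq_or_lt with rfl | h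
    · exact ⟨hn ▸ F.lt_mul hcm.1, .inr hn⟩
    · exact ⟨(hsep m.succ_pos h).1, .inl (hkey m.succ_pos h)⟩
  exact ⟨hcm.1, hleft, hmul, hright, hK⟩

theorem failsAtMost_of_worst_le (F : FailureProfile p q D K) (hn : 0 < n)
    (h : IsSpanning p q K n c a) (hv : ∀ m < n, worst D K (c (m + 1)) (a m) (a (m + 1)) ≤ v) :
    FailsAtMost D p q n c v := by
  intro l hl
  obtain ⟨m, hm, hml⟩ := exists_mem_Icc_succ hn (h.left.trans_le hl.1) (hl.2.trans h.right.ge)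
  exact ⟨m + 1, ⟨by omega, hm⟩, (F.failure_le_worst (h.spans m hm) hml).trans (hv m hm)⟩

theorem failure_left_le_of_le (F : FailureProfile p q D K) {x y u w : ℝ}
    (h : Spans p q K x u w) (hy : 0 ≤ y) (hyx : y ≤ x) : failure D x u ≤ failure D y u := by
  rcases hyx.eq_or_lt with rfl | hyx
  · rfl
  · exact (F.failure_lt_left hy (F.pos.trans_le h.le_left) (F.left_lt_one h) hyx
      h.mul_left_le).le

theorem failure_min_key_le_of_le (F : FailureProfile p q D K) {x y u w : ℝ}
    (h : Spans p q K x u w) (hy : y ≤ 1) (hxy : x ≤ y) :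
    failure D x (min w (K x)) ≤ failure D y (min w (K x)) := by
  have hx := F.ratio_mem h
  obtain ⟨hl, hxl⟩ := F.min_key_mem hx h.lt_mul_right
  have hl0 := F.pos.trans hl
  rcases hxy.eq_or_lt with rfl | hxy
  · rfl
  · exact (F.failure_lt_right hl0 ((min_le_right _ _).trans_lt (F.key_lt_one x hx)) hxy hxl.le
      (F.mul_mem ⟨hx.1.trans hxy, hy⟩ ⟨hl0.le, (min_le_left _ _).trans (F.right_le h)⟩).2).le

theorem left_mem_Icc (F : FailureProfile p q D K) (h : IsSpanning p q K n c a) {m : ℕ}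
    (hm : m < n) : a m ∈ Icc p q :=
  ⟨(h.spans m hm).le_left, by
    have hs := h.spans m hm
    exact (lt_of_mul_lt_mul_left (hs.mul_left_le.trans_lt (F.lt_mul hs.lt_ratio))
      (F.ratio_pos hs.lt_ratio).le).le⟩

theorem min_key_mem_Icc (F : FailureProfile p q D K) (h : IsSpanning p q K n c a) {m : ℕ}
    (hm : m < n) : min (a (m + 1)) (K (c (m + 1))) ∈ Icc p q :=
  ⟨(F.min_key_mem (F.ratio_mem (h.spans m hm)) (h.spans m hm).lt_mul_right).1.le,
    (min_le_left _ _).trans (F.right_le (h.spans m hm))⟩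

theorem min_key_of_lt (F : FailureProfile p q D K) (h : IsSpanning p q K n c a) {m : ℕ}
    (hm : m + 1 < n) : min (a (m + 1)) (K (c (m + 1))) = a (m + 1) :=
  min_eq_left (F.right_lt_key (h.spans m (by omega)) (h.spans (m + 1) hm)).le

theorem min_key_last (F : FailureProfile p q D K) (h : IsSpanning p q K n c a) {m : ℕ}
    (hm : m + 1 = n) : min (a (m + 1)) (K (c (m + 1))) = K (c n) := by
  subst hm
  rw [h.right]
  exact min_eq_right (F.key_le _ (F.ratio_mem (h.spans m m.lt_succ_self)))

/-- If all spanned intervals are equally bad, then no other choice of `n` ratios is better: of the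
`n + 1` points where the value `e` is attained, any other curve stays below `e` at one at most. -/
theorem le_of_failsAtMost (F : FailureProfile p q D K) {e : ℝ} (h : IsSpanning p q K n c a)
    (hleft : ∀ m < n, failure D (c (m + 1)) (a m) = e)
    (hright : ∀ m < n, failure D (c (m + 1)) (min (a (m + 1)) (K (c (m + 1)))) = e)
    (hd : ∀ m ∈ Icc 1 n, d m ∈ Ioc (p / q) 1) (hv : FailsAtMost D p q n d v) : e ≤ v := by
  by_contra! hve
  have lt_ratio {m i : ℕ} (hm : m ∈ Icc 1 n) (hi : i < n) (hf : failure D (d m) (a i) ≤ v) :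
      c (i + 1) < d m := by
    by_contra! hle
    exact ((hf.trans_lt hve).trans_eq (hleft i hi).symm).not_ge
      (F.failure_left_le_of_le (h.spans i hi) (F.ratio_pos (hd m hm).1).le hle)
  have ratio_lt {m i : ℕ} (hm : m ∈ Icc 1 n) (hi : i < n)
      (hf : failure D (d m) (min (a (i + 1)) (K (c (i + 1)))) ≤ v) : d m < c (i + 1) := by
    by_contra! hle
    exact ((hf.trans_lt hve).trans_eq (hright i hi).symm).not_ge
      (F.failure_min_key_le_of_le (h.spans i hi) (hd m hm).2 hle)
  have hbetween : ∀ j ∈ Finset.range (n + 1), ∃ m ∈ Finset.Icc 1 n,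
      (j < n → c (j + 1) < d m) ∧ (0 < j → d m < c j) := by
    simp only [Finset.mem_range, Finset.mem_Icc]
    rintro (_ | i) hj
    · rcases n.eq_zero_or_pos with rfl | hn
      · obtain ⟨m, hm, -⟩ := hv p ⟨le_rfl, F.lt.le⟩
        exact ⟨m, hm, by omega, by omega⟩
      obtain ⟨m, hm, hmf⟩ := hv (a 0) (F.left_mem_Icc h hn)
      exact ⟨m, hm, fun _ => lt_ratio hm hn hmf, by omega⟩
    · have hi : i < n := Nat.succ_lt_succ_iff.1 hj
      obtain ⟨m, hm, hmf⟩ := hv _ (F.min_key_mem_Icc h hi)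
      refine ⟨m, hm, fun hi' => lt_ratio hm hi' ?_, fun _ => ratio_lt hm hi hmf⟩
      rwa [F.min_key_of_lt h hi'] at hmf
  choose! f hf hlt hgt using hbetween
  obtain ⟨i, hi, j, hj, hij, hfij⟩ := Finset.exists_ne_map_eq_of_card_lt_of_maps_to
    (s := Finset.range (n + 1)) (t := Finset.Icc 1 n) (by simp) hf
  wlog hlt' : i < j generalizing i j
  · exact this j hj i hi hij.symm hfij.symm (by omega)
  have hjn : j ≤ n := Nat.lt_succ_iff.1 (Finset.mem_range.1 hj)
  have hle := (h.strictAntiOn F.pos).antitoneOn (a := i + 1) (b := j) ⟨by omega, by omega⟩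
    ⟨by omega, hjn⟩ hlt'
  exact ((hlt i hi (by omega)).trans_eq (congrArg d hfij)).not_ge
    ((hgt j hj (by omega)).le.trans hle)

theorem exists_failsAtMost_lt (F : FailureProfile p q D K) {V : ℝ} (h : IsSpanning p q K n c a)
    (hV : ∀ m < n, worst D K (c (m + 1)) (a m) (a (m + 1)) ≤ V)
    (hlt : ∃ m < n, failure D (c (m + 1)) (a m) < V ∨
      failure D (c (m + 1)) (min (a (m + 1)) (K (c (m + 1)))) < V) :
    ∃ d, AdmissibleRatios p q n d ∧ ∃ v < V, FailsAtMost D p q n d v := by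
  obtain ⟨m₀, hm₀, hlt⟩ := hlt
  have hn : 0 < n := by omega
  obtain ⟨b, hb0, hbn, hb⟩ := exists_chain_of_step
    (L := fun u w => ∃ x, Spans p q K x u w ∧ worst D K x u w ≤ V)
    (S := fun u w => ∃ x, Spans p q K x u w ∧ worst D K x u w < V) (w := a) (n := n)
    (fun _ _ ⟨x, hx, hxV⟩ => ⟨x, hx, hxV.le⟩)
    (fun _ _ _ ⟨x, hx, hxV⟩ ⟨y, hy, hyV⟩ hS => hS.elim
      (fun ⟨_, hx, hxV⟩ => F.exists_point_worst_lt hx hy hxV.le hyV (.inl hxV))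
      (fun ⟨_, hy, hyV⟩ => F.exists_point_worst_lt hx hy hxV hyV.le (.inr hyV)))
    (fun m hm => ⟨c (m + 1), h.spans m hm, hV m hm⟩)
    ⟨m₀, hm₀, F.exists_worst_lt (h.spans m₀ hm₀) (hV m₀ hm₀) hlt⟩
  choose! d hd hdV using hb
  have hspan : IsSpanning p q K n (fun m => d (m - 1)) b :=
    ⟨hb0.trans h.left, hbn.trans h.right, hd⟩
  obtain ⟨m, hm, hmax⟩ := Finset.exists_max_image (Finset.range n)
    (fun m => worst D K (d m) (b m) (b (m + 1))) ⟨0, Finset.mem_range.2 hn⟩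
  exact ⟨_, F.admissibleRatios hspan, _, hdV m (Finset.mem_range.1 hm),
    F.failsAtMost_of_worst_le hn hspan fun i hi => hmax i (Finset.mem_range.2 hi)⟩

theorem failure_left_le_of_failsAtMost (F : FailureProfile p q D K)
    (h : IsSpanning p q K n c a)
    (hcross : ∀ m, 1 ≤ m → m < n → failure D (c m) (a m) = failure D (c (m + 1)) (a m))
    (hv : FailsAtMost D p q n c v) {m : ℕ} (hm : m < n) : failure D (c (m + 1)) (a m) ≤ v := by
  obtain ⟨hc, hanti⟩ := F.admissibleRatios h
  obtain ⟨i, hi, hiv⟩ := hv (a m) (F.left_mem_Icc h hm)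
  rcases Nat.lt_or_ge m i with hmi | hmi
  · exact (F.failure_left_le_of_le (h.spans m hm) (F.ratio_pos (hc i hi).1).le
      (hanti.antitoneOn ⟨by omega, hm⟩ hi hmi)).trans hiv
  · obtain ⟨j, rfl⟩ : ∃ j, m = j + 1 := ⟨m - 1, by grind⟩
    rw [← hcross (j + 1) j.succ_pos hm]
    have hle := F.failure_min_key_le_of_le (h.spans j (by omega)) (hc i hi).2
      (hanti.antitoneOn hi ⟨j.succ_pos, hm.le⟩ hmi)
    rw [F.min_key_of_lt h hm] at hle
    exact hle.trans hiv

theorem worst_le_of_failsAtMost (F : FailureProfile p q D K) (h : IsSpanning p q K n c a)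
    (hcross : ∀ m, 1 ≤ m → m < n → failure D (c m) (a m) = failure D (c (m + 1)) (a m))
    (hv : FailsAtMost D p q n c v) {m : ℕ} (hm : m < n) :
    worst D K (c (m + 1)) (a m) (a (m + 1)) ≤ v := by
  refine max_le (F.failure_left_le_of_failsAtMost h hcross hv hm) ?_
  rcases (Nat.succ_le_iff.2 hm).lt_or_eq with hm' | rfl
  · rw [F.min_key_of_lt h hm', hcross (m + 1) m.succ_pos hm']
    exact F.failure_left_le_of_failsAtMost h hcross hv hm'
  · obtain ⟨hc, hanti⟩ := F.admissibleRatios h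
    obtain ⟨i, hi, hiv⟩ := hv _ (F.min_key_mem_Icc h hm)
    exact (F.failure_min_key_le_of_le (h.spans m hm) (hc i hi).2
      (hanti.antitoneOn hi ⟨m.succ_pos, le_rfl⟩ hi.2)).trans hiv

theorem failsAtMost_iff_forall_Ico (F : FailureProfile p q D K) :
    FailsAtMost D p q n c v ↔ ∀ l ∈ Ico p q, ∃ m ∈ Icc 1 n, failure D (c m) l ≤ v := by
  refine ⟨fun h l hl => h l (Ico_subset_Icc_self hl), fun h => ?_⟩
  have hclosed : IsClosed (⋃ m ∈ Icc 1 n, {l | failure D (c m) l ≤ v}) := by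
    refine (finite_Icc 1 n).isClosed_biUnion fun m _ => isClosed_le ?_ continuous_const
    have := F.cont
    unfold failure
    fun_prop
  have hsub : Ico p q ⊆ ⋃ m ∈ Icc 1 n, {l | failure D (c m) l ≤ v} := fun l hl => by
    simpa only [mem_iUnion₂, mem_ofPred_eq, exists_prop] using h l hl
  intro l hl
  rw [← closure_Ico F.lt.ne] at hl
  simpa only [mem_iUnion₂, mem_ofPred_eq, exists_prop] using closure_minimal hsub hclosed hl

theorem forall_failsAtMost_iff (F : FailureProfile p q D K) (hn : 0 < n)
    (h : IsSpanning p q K n c a)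
    (hcross : ∀ m, 1 ≤ m → m < n → failure D (c m) (a m) = failure D (c (m + 1)) (a m)) :
    (∀ d, AdmissibleRatios p q n d → ∀ v, FailsAtMost D p q n d v → FailsAtMost D p q n c v) ↔
      ∀ m < n, failure D (c (m + 1)) (a m) = failure D (c n) (K (c n)) := by
  set e := failure D (c n) (K (c n))
  constructor
  · intro hopt
    obtain ⟨M, hM, hmax⟩ := Finset.exists_max_image (Finset.range n)
      (fun m => worst D K (c (m + 1)) (a m) (a (m + 1))) ⟨0, Finset.mem_range.2 hn⟩
    rw [Finset.mem_range] at hM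
    simp only [Finset.mem_range] at hmax
    set V := worst D K (c (M + 1)) (a M) (a (M + 1))
    have hno : ¬∃ m < n, failure D (c (m + 1)) (a m) < V ∨
        failure D (c (m + 1)) (min (a (m + 1)) (K (c (m + 1)))) < V := by
      intro hlt
      obtain ⟨d, hd, v, hvV, hdv⟩ := F.exists_failsAtMost_lt h hmax hlt
      exact (F.worst_le_of_failsAtMost h hcross (hopt d hd v hdv) hM).not_gt hvV
    push Not at hno
    have heV : e = V := by
      obtain ⟨j, rfl⟩ : ∃ j, n = j + 1 := ⟨n - 1, by omega⟩
      have hj := F.min_key_last h rfl ▸ (hno j j.lt_succ_self).2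
      have hj' := F.min_key_last h rfl ▸ (le_max_right _ _).trans (hmax j j.lt_succ_self)
      exact hj'.antisymm hj
    intro m hm
    exact heV ▸ ((le_max_left _ _).trans (hmax m hm)).antisymm (hno m hm).1
  · intro he d hd v hv
    have hright : ∀ m < n, failure D (c (m + 1)) (min (a (m + 1)) (K (c (m + 1)))) = e := by
      intro m hm
      rcases (Nat.succ_le_iff.2 hm).lt_or_eq with hm' | rfl
      · rw [F.min_key_of_lt h hm', hcross (m + 1) m.succ_pos hm', he (m + 1) hm']
      · rw [F.min_key_last h rfl]
    exact F.failsAtMost_of_worst_le hn h fun m hm =>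
      (max_le (he m hm).le (hright m hm).le).trans (F.le_of_failsAtMost h he hright hd.1 hv)

end FailureProfile

/-! ### Trigonometric monotonicity -/

theorem sin_sq_strictMonoOn : StrictMonoOn (fun β => Real.sin β ^ 2) (Icc 0 (Real.pi / 2)) :=
  fun x hx y hy hxy => by
    have hpi := Real.pi_pos
    exact pow_lt_pow_left₀ (Real.strictMonoOn_sin ⟨by linarith [hx.1], hx.2⟩
      ⟨by linarith [hy.1], hy.2⟩ hxy)
      (Real.sin_nonneg_of_nonneg_of_le_pi hx.1 (by linarith [hx.2])) two_ne_zero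

theorem exists_sin_sq_eq {A B y : ℝ} (hAB : A ≤ B)
    (hy : y ∈ Icc (Real.sin A ^ 2) (Real.sin B ^ 2)) : ∃ β ∈ Icc A B, Real.sin β ^ 2 = y :=
  intermediate_value_Icc hAB (by fun_prop) hy

theorem strictAntiOn_cos_mul_div_cos {N B : ℝ} (hN : 1 < N) (hNB : (N + 1) * B ≤ Real.pi) :
    StrictAntiOn (fun β => Real.cos (N * β) / Real.cos β) (Icc 0 B) := by
  rintro x ⟨hx, -⟩ y ⟨hy, hyB⟩ hxy
  have hy_pi : (N + 1) * y ≤ Real.pi := (by gcongr : (N + 1) * y ≤ (N + 1) * B).trans hNB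
  have hcos {z : ℝ} (hz : 0 ≤ z) (hzy : z ≤ y) : 0 < Real.cos z :=
    Real.cos_pos_of_mem_Ioo ⟨by linarith [Real.pi_pos], by nlinarith⟩
  have hadd : Real.cos (N * y + x) < Real.cos (N * x + y) :=
    Real.cos_lt_cos_of_nonneg_of_le_pi (by positivity) (by linarith) (by nlinarith)
  have hsub : Real.cos (N * y - x) < Real.cos (N * x - y) := by
    rw [← Real.cos_abs (N * x - y)]
    refine Real.cos_lt_cos_of_nonneg_of_le_pi (abs_nonneg _) (by linarith) (abs_lt.2 ⟨?_, ?_⟩) <;>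
      nlinarith
  refine (div_lt_div_iff₀ (hcos hy le_rfl) (hcos hx hxy.le)).2 ?_
  linarith [Real.two_mul_cos_mul_cos (N * y) x, Real.two_mul_cos_mul_cos (N * x) y]

theorem hasDerivAt_sub_sin_sq_mul_cos_sq (N c x : ℝ) :
    HasDerivAt (fun β => (c - Real.sin β ^ 2) * Real.cos (N * β) ^ 2)
      (2 * -Real.cos (N * x) * (N * (c - Real.sin x ^ 2) * Real.sin (N * x) +
        Real.sin x * Real.cos x * Real.cos (N * x))) x := by
  refine ((((Real.hasDerivAt_sin x).pow 2).const_sub c).mul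
    ((((hasDerivAt_id x).const_mul N).cos).pow 2)).congr_deriv ?_
  simp only [id, Pi.pow_apply, Nat.cast_ofNat, Nat.add_one_sub_one, pow_one]
  ring

theorem one_le_mul_sin {N x : ℝ} (hN : 0 ≤ N) (hx0 : 0 ≤ x) (hx : x ≤ Real.pi / 2)
    (hNx : Real.pi / 2 ≤ N * x) : 1 ≤ N * Real.sin x :=
  calc 1 ≤ N * (2 / Real.pi * x) := by
        rw [show N * (2 / Real.pi * x) = 2 * (N * x) / Real.pi by ring, le_div_iff₀ Real.pi_pos]
        linarith
    _ ≤ N * Real.sin x := mul_le_mul_of_nonneg_left (Real.mul_le_sin hx0 hx) hN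

theorem strictMonoOn_sub_sin_sq_mul_cos_sq {N c A B : ℝ} (hN : 2 ≤ N)
    (hA : Real.pi / 2 ≤ N * A) (hB : N * B ≤ 5 * Real.pi / 6) (hc : 4 * Real.sin B ^ 2 ≤ c) :
    StrictMonoOn (fun β => (c - Real.sin β ^ 2) * Real.cos (N * β) ^ 2) (Icc A B) := by
  have hpi := Real.pi_pos
  refine strictMonoOn_of_deriv_pos (convex_Icc A B) (fun x _ =>
    (hasDerivAt_sub_sin_sq_mul_cos_sq N c x).continuousAt.continuousWithinAt) fun x hx => ?_
  rw [interior_Icc] at hx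
  rw [(hasDerivAt_sub_sin_sq_mul_cos_sq N c x).deriv]
  have hNx : Real.pi / 2 < N * x := by nlinarith [hx.1]
  have hNx' : N * x < 5 * Real.pi / 6 := by nlinarith [hx.2]
  have hx0 : 0 < x := by nlinarith
  have hB2 : B ≤ Real.pi / 2 := by nlinarith [hx.2]
  have hcosN : Real.cos (N * x) < 0 :=
    Real.cos_neg_of_pi_div_two_lt_of_lt hNx (by linarith)
  have hsinN : 1 / 2 < Real.sin (N * x) := by
    have : Real.sin (Real.pi / 6) < Real.sin (Real.pi - N * x) :=
      Real.sin_lt_sin_of_lt_of_le_pi_div_two (by linarith) (by linarith) (by linarith)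
    rwa [Real.sin_pi_sub, Real.sin_pi_div_six] at this
  have hsin : 0 < Real.sin x := Real.sin_pos_of_pos_of_lt_pi hx0 (by linarith [hx.2])
  have hNsin : 1 ≤ N * Real.sin x :=
    one_le_mul_sin (by linarith) hx0.le (hx.2.le.trans hB2) hNx.le
  have hcsin : 3 * Real.sin x ^ 2 ≤ c - Real.sin x ^ 2 := by
    have : Real.sin x ^ 2 ≤ Real.sin B ^ 2 := sin_sq_strictMonoOn.monotoneOn
      ⟨hx0.le, hx.2.le.trans hB2⟩ ⟨hx0.le.trans hx.2.le, hB2⟩ hx.2.le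
    linarith
  have hfirst : Real.sin x < N * (c - Real.sin x ^ 2) * Real.sin (N * x) := by
    calc Real.sin x < 3 * Real.sin x * (1 * (1 / 2)) := by linarith
      _ ≤ 3 * Real.sin x * (N * Real.sin x * Real.sin (N * x)) := by gcongr
      _ = N * (3 * Real.sin x ^ 2) * Real.sin (N * x) := by ring
      _ ≤ N * (c - Real.sin x ^ 2) * Real.sin (N * x) := by gcongr
  have hsecond : -Real.sin x ≤ Real.sin x * Real.cos x * Real.cos (N * x) := by
    have : |Real.cos x * Real.cos (N * x)| ≤ 1 := by
      rw [abs_mul]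
      exact mul_le_one₀ (Real.abs_cos_le_one _) (abs_nonneg _) (Real.abs_cos_le_one _)
    nlinarith [(abs_le.1 this).1]
  exact mul_pos (by linarith) (by linarith)

/-- The angle with `piMax k = sin² (maxAngle k)`. -/
noncomputable def maxAngle (k : ℕ) : ℝ := Real.pi / (4 * k + 2)

theorem sin_maxAngle_sq (k : ℕ) : Real.sin (maxAngle k) ^ 2 = piMax k := rfl

theorem maxAngle_pos (k : ℕ) : 0 < maxAngle k := by
  unfold maxAngle
  positivity

theorem maxAngle_strictAnti : StrictAnti maxAngle := fun j k hjk => by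
  unfold maxAngle
  gcongr

theorem maxAngle_zero : maxAngle 0 = Real.pi / 2 := by simp [maxAngle]

theorem maxAngle_mem (k : ℕ) : maxAngle k ∈ Icc 0 (Real.pi / 2) :=
  ⟨(maxAngle_pos k).le, maxAngle_zero ▸ maxAngle_strictAnti.antitone k.zero_le⟩

theorem maxAngle_one : maxAngle 1 = Real.pi / 6 := by norm_num [maxAngle]

theorem two_mul_add_one_mul_maxAngle (k : ℕ) : (2 * k + 1) * maxAngle k = Real.pi / 2 := by
  unfold maxAngle
  field_simp
  ring

theorem piMax_strictAnti : StrictAnti piMax := fun _ _ h =>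
  sin_sq_strictMonoOn (maxAngle_mem _) (maxAngle_mem _) (maxAngle_strictAnti h)

theorem piMax_zero : piMax 0 = 1 := by
  rw [← sin_maxAngle_sq, maxAngle_zero, Real.sin_pi_div_two, one_pow]

theorem piMax_one : piMax 1 = 1 / 4 := by
  rw [← sin_maxAngle_sq, maxAngle_one, Real.sin_pi_div_six]
  norm_num

theorem piMax_pos (k : ℕ) : 0 < piMax k :=
  pow_pos (Real.sin_pos_of_pos_of_lt_pi (maxAngle_pos k)
    (by linarith [(maxAngle_mem k).2, Real.pi_pos])) 2

theorem cos_pos_of_le_maxAngle {k : ℕ} (hk : 1 ≤ k) {β : ℝ} (h0 : 0 ≤ β) (hβ : β ≤ maxAngle k) :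
    0 < Real.cos β :=
  Real.cos_pos_of_mem_Ioo ⟨by linarith [Real.pi_pos],
    hβ.trans_lt (maxAngle_zero ▸ maxAngle_strictAnti hk)⟩

theorem failPoly_piMax {k : ℕ} (hk : 1 ≤ k) : failPoly k (piMax k) = 0 := by
  have hcos := cos_pos_of_le_maxAngle hk (maxAngle_pos k).le le_rfl
  rw [← sin_maxAngle_sq, failPoly_sin_sq k hcos.ne', two_mul_add_one_mul_maxAngle,
    Real.cos_pi_div_two, zero_div]

/-- The point `λ_key` in terms of the phase ratio. -/
noncomputable def keyRatio (k : ℕ) (c : ℝ) : ℝ :=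
  if k = 1 then (1 + 8 * c) / (12 * c) else piMax (k - 1)

theorem lamKey_eq (k : ℕ) (φ : ℝ) : lamKey k φ = keyRatio k (phaseRatio φ) := by
  unfold lamKey keyRatio phaseRatio
  split_ifs
  · congr 1 <;> ring
  · rfl

/-! ### The failure profile on `Λ_k` -/

theorem failure_sin_sq_div (k : ℕ) {c β : ℝ} (hc : c ≠ 0) (hβ : Real.cos β ≠ 0) :
    failure (failPoly k) c (Real.sin β ^ 2 / c) =
      (c - Real.sin β ^ 2) * Real.cos ((2 * k + 1) * β) ^ 2 / (c * Real.cos β ^ 2) := by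
  rw [failure, mul_div_cancel₀ _ hc, failPoly_sin_sq k hβ]
  field_simp

section

variable {j : ℕ}

theorem mul_maxAngle_pred_le (hj : 1 ≤ j) :
    (2 * (j + 1 : ℕ) + 1) * maxAngle j ≤ 5 * Real.pi / 6 := by
  have h1 : maxAngle j ≤ maxAngle 1 := maxAngle_strictAnti.antitone hj
  rw [maxAngle_one] at h1
  push_cast
  linarith [two_mul_add_one_mul_maxAngle j]

theorem strictAntiOn_failPoly_succ (hj : 1 ≤ j) :
    StrictAntiOn (failPoly (j + 1)) (Icc 0 (piMax j)) := by
  have hB := maxAngle_mem j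
  have hmem {β : ℝ} (hβ : β ∈ Icc 0 (maxAngle j)) : β ∈ Icc 0 (Real.pi / 2) :=
    ⟨hβ.1, hβ.2.trans hB.2⟩
  rw [← sin_maxAngle_sq, show (0 : ℝ) = Real.sin 0 ^ 2 by simp]
  intro x hx y hy hxy
  obtain ⟨β, hβ, rfl⟩ := exists_sin_sq_eq hB.1 hx
  obtain ⟨γ, hγ, rfl⟩ := exists_sin_sq_eq hB.1 hy
  rw [failPoly_sin_sq _ (cos_pos_of_le_maxAngle hj hβ.1 hβ.2).ne',
    failPoly_sin_sq _ (cos_pos_of_le_maxAngle hj hγ.1 hγ.2).ne']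
  have hN : (1 : ℝ) < 2 * (j + 1 : ℕ) + 1 := by
    push_cast
    linarith [j.cast_nonneg (α := ℝ)]
  have h1 : maxAngle j ≤ maxAngle 1 := maxAngle_strictAnti.antitone hj
  rw [maxAngle_one] at h1
  exact strictAntiOn_cos_mul_div_cos hN (by linarith [mul_maxAngle_pred_le hj]) hβ hγ
    ((sin_sq_strictMonoOn.lt_iff_lt (hmem hβ) (hmem hγ)).1 hxy)

theorem piMax_le_quarter (hj : 1 ≤ j) : piMax j ≤ 1 / 4 :=
  piMax_one ▸ piMax_strictAnti.antitone hj

theorem failure_sin_sq_div_lt (hj : 1 ≤ j) {c β γ : ℝ} (hc : 0 < c)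
    (hβ : maxAngle (j + 1) ≤ β) (hβγ : β < γ) (hγ : γ ≤ maxAngle j)
    (hγc : Real.sin γ ^ 2 ≤ c * piMax j) :
    failure (failPoly (j + 1)) c (Real.sin β ^ 2 / c) <
      failure (failPoly (j + 1)) c (Real.sin γ ^ 2 / c) := by
  have hβ0 := (maxAngle_pos (j + 1)).le.trans hβ
  have hγ0 := hβ0.trans hβγ.le
  have hcosβ := cos_pos_of_le_maxAngle hj hβ0 (hβγ.le.trans hγ)
  have hcosγ := cos_pos_of_le_maxAngle hj hγ0 hγ
  have hγc4 : 4 * Real.sin γ ^ 2 ≤ c := by nlinarith [piMax_le_quarter hj]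
  have hN : (2 : ℝ) ≤ 2 * (j + 1 : ℕ) + 1 := by
    push_cast
    linarith [j.cast_nonneg (α := ℝ)]
  have hnum : (c - Real.sin β ^ 2) * Real.cos ((2 * (j + 1 : ℕ) + 1) * β) ^ 2 <
      (c - Real.sin γ ^ 2) * Real.cos ((2 * (j + 1 : ℕ) + 1) * γ) ^ 2 :=
    strictMonoOn_sub_sin_sq_mul_cos_sq hN (two_mul_add_one_mul_maxAngle (j + 1)).ge
      ((mul_le_mul_of_nonneg_left hγ (by linarith)).trans (mul_maxAngle_pred_le hj)) hγc4
      ⟨hβ, hβγ.le⟩ ⟨hβ.trans hβγ.le, le_rfl⟩ hβγ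
  have hden : c * Real.cos γ ^ 2 ≤ c * Real.cos β ^ 2 := by
    have : Real.cos γ ≤ Real.cos β := Real.cos_le_cos_of_nonneg_of_le_pi hβ0
      (by linarith [(maxAngle_mem j).2, Real.pi_pos]) hβγ.le
    gcongr
  rw [failure_sin_sq_div _ hc.ne' hcosβ.ne', failure_sin_sq_div _ hc.ne' hcosγ.ne']
  exact div_lt_div₀ hnum hden (mul_nonneg (by linarith [sq_nonneg (Real.sin γ)]) (sq_nonneg _))
    (by positivity)

theorem failure_failPoly_succ_lt (hj : 1 ≤ j) {c l m : ℝ} (hc : c ∈ Ioc 0 1)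
    (hl : piMax (j + 1) ≤ c * l) (hlm : l < m) (hm : m ≤ piMax j) :
    failure (failPoly (j + 1)) c l < failure (failPoly (j + 1)) c m := by
  have hlt : c * l < c * m := mul_lt_mul_of_pos_left hlm hc.1
  have hcm : c * m ≤ c * piMax j := mul_le_mul_of_nonneg_left hm hc.1.le
  have hcj : c * piMax j ≤ piMax j := mul_le_of_le_one_left (piMax_pos j).le hc.2
  have hA := (maxAngle_strictAnti j.lt_succ_self).le
  obtain ⟨β, hβ, hβl⟩ := exists_sin_sq_eq hA (y := c * l) ⟨hl, (hlt.le.trans hcm).trans hcj⟩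
  obtain ⟨γ, hγ, hγm⟩ := exists_sin_sq_eq hA (y := c * m) ⟨hl.trans hlt.le, hcm.trans hcj⟩
  have hmem {x : ℝ} (hx : x ∈ Icc (maxAngle (j + 1)) (maxAngle j)) : x ∈ Icc 0 (Real.pi / 2) :=
    ⟨(maxAngle_pos _).le.trans hx.1, hx.2.trans (maxAngle_mem j).2⟩
  have hβγ : β < γ :=
    (sin_sq_strictMonoOn.lt_iff_lt (hmem hβ) (hmem hγ)).1 (by simpa only [hβl, hγm])
  have h := failure_sin_sq_div_lt hj hc.1 hβ.1 hβγ hγ.2 (hγm.trans_le hcm)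
  rwa [hβl, hγm, mul_div_cancel_left₀ l hc.1.ne', mul_div_cancel_left₀ m hc.1.ne'] at h

theorem failureProfile_succ (hj : 1 ≤ j) :
    FailureProfile (piMax (j + 1)) (piMax j) (failPoly (j + 1)) (keyRatio (j + 1)) := by
  have hkey : keyRatio (j + 1) = fun _ => piMax j := by
    funext c
    rw [keyRatio, if_neg (by omega), Nat.add_sub_cancel]
  have hq4 := piMax_le_quarter hj
  have hratio {c : ℝ} (hc : c ∈ Ioc (piMax (j + 1) / piMax j) 1) : c ∈ Ioc 0 1 :=
    ⟨(div_pos (piMax_pos _) (piMax_pos _)).trans hc.1, hc.2⟩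
  rw [hkey]
  exact
    { pos := piMax_pos (j + 1)
      lt := piMax_strictAnti j.lt_succ_self
      le_one := by linarith
      cont := continuous_failPoly _
      anti := strictAntiOn_failPoly_succ hj
      zero := failPoly_piMax (by omega)
      key_gt := fun c hc => (div_lt_iff₀ (piMax_pos j)).1 hc.1
      key_le := fun _ _ => le_rfl
      key_lt_one := fun _ _ => by linarith
      key_cont := fun _ _ => continuousAt_const
      mono := fun c hc l l' h hl hl' => failure_failPoly_succ_lt hj (hratio hc) h hl hl'
      le_key := fun c hc l h hl => by
        rcases hl.eq_or_lt with rfl | hl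
        · exact le_rfl
        · exact (failure_failPoly_succ_lt hj (hratio hc) h hl le_rfl).le
      cross_lt_key := fun _ _ _ _ _ _ _ hl _ => hl }

end

theorem keyRatio_one (c : ℝ) : keyRatio 1 c = (1 + 8 * c) / (12 * c) := if_pos rfl

theorem mul_failure_failPoly_one (c l : ℝ) : 4 * c * failure (failPoly 1) c l =
    (4 * c - 1 - (4 * (c * l) - 1)) * (4 * (c * l) - 1) ^ 2 := by
  rw [failure, failPoly_one]
  ring

theorem four_mul_mul_keyRatio_one {c : ℝ} (hc : c ≠ 0) :
    4 * (c * keyRatio 1 c) - 1 = 2 / 3 * (4 * c - 1) := by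
  rw [keyRatio_one]
  field_simp
  ring

theorem strictMonoOn_sub_mul_sq (a : ℝ) :
    StrictMonoOn (fun u => (a - u) * u ^ 2) (Icc 0 (2 / 3 * a)) := by
  intro u hu v hv huv
  have : 0 < (v - u) * (a * (u + v) - (u ^ 2 + u * v + v ^ 2)) :=
    mul_pos (by linarith) (by nlinarith [hu.1, hv.2])
  dsimp only
  linarith

theorem failure_failPoly_one_lt {c l m : ℝ} (hc : 0 < c) (hl : 1 / 4 ≤ c * l) (hlm : l < m)
    (hm : m ≤ keyRatio 1 c) : failure (failPoly 1) c l < failure (failPoly 1) c m := by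
  have hkey := four_mul_mul_keyRatio_one hc.ne'
  have hclm : c * l < c * m := mul_lt_mul_of_pos_left hlm hc
  have hcm : c * m ≤ c * keyRatio 1 c := mul_le_mul_of_nonneg_left hm hc.le
  refine lt_of_mul_lt_mul_left (a := 4 * c) ?_ (by linarith)
  rw [mul_failure_failPoly_one, mul_failure_failPoly_one]
  exact strictMonoOn_sub_mul_sq (4 * c - 1) ⟨by linarith, by linarith⟩
    ⟨by linarith, by linarith⟩ (by linarith)

theorem sub_mul_sq_le {a u : ℝ} (ha : 0 ≤ a) (hu : 0 ≤ u) :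
    (a - u) * u ^ 2 ≤ (a - 2 / 3 * a) * (2 / 3 * a) ^ 2 := by
  nlinarith [mul_nonneg (sq_nonneg (u - 2 / 3 * a)) (by linarith : 0 ≤ u + a / 3)]

theorem lt_keyRatio_one_of_crossing {c c' l : ℝ} (hc : 1 / 4 < c) (hc' : 1 / 4 < c')
    (hl : 0 < l) (h : failPoly 1 (c * l) + failPoly 1 (c' * l) = 0) : l < keyRatio 1 c := by
  rw [failPoly_one, failPoly_one] at h
  have hsum : l * (4 * c + 1) < 2 := by nlinarith
  have hprod : 0 ≤ (4 * c - 1) * (8 * c - 1) := mul_nonneg (by linarith) (by linarith)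
  rw [keyRatio_one, lt_div_iff₀ (by linarith)]
  refine lt_of_mul_lt_mul_right (a := 4 * c + 1) ?_ (by linarith)
  nlinarith [hprod]

theorem failureProfile_one : FailureProfile (piMax 1) (piMax 0) (failPoly 1) (keyRatio 1) := by
  rw [piMax_one, piMax_zero]
  have hratio {c : ℝ} (hc : c ∈ Ioc (1 / 4 / 1 : ℝ) 1) : 1 / 4 < c ∧ 0 < c := by
    have := hc.1
    constructor <;> linarith
  exact
    { pos := by norm_num
      lt := by norm_num
      le_one := le_rfl
      cont := continuous_failPoly 1
      anti := fun x _ y _ h => by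
        rw [failPoly_one, failPoly_one]
        linarith
      zero := by norm_num [failPoly_one]
      key_gt := fun c hc => by
        linarith [hratio hc, four_mul_mul_keyRatio_one (hratio hc).2.ne']
      key_le := fun c hc => by
        rw [keyRatio_one, div_le_one (by linarith [hratio hc])]
        linarith [hratio hc]
      key_lt_one := fun c hc => by
        rw [keyRatio_one, div_lt_one (by linarith [hratio hc])]
        linarith [hratio hc]
      key_cont := fun c hc => by
        rw [funext keyRatio_one]
        exact ContinuousAt.div (by fun_prop) (by fun_prop) (by linarith [hratio hc])
      mono := fun c hc _ _ h hlm hm => failure_failPoly_one_lt (hratio hc).2 h hlm hm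
      le_key := fun c hc l h _ => by
        obtain ⟨hc4, hc0⟩ := hratio hc
        refine le_of_mul_le_mul_left (a := 4 * c) ?_ (by linarith)
        rw [mul_failure_failPoly_one, mul_failure_failPoly_one, four_mul_mul_keyRatio_one hc0.ne']
        exact sub_mul_sq_le (by linarith) (by linarith)
      cross_lt_key := fun c hc c' hc' _ l hl _ h =>
        lt_keyRatio_one_of_crossing (hratio hc).1 (hratio hc').1 hl h }

theorem failureProfile {k : ℕ} (hk : 1 ≤ k) :
    FailureProfile (piMax k) (piMax (k - 1)) (failPoly k) (keyRatio k) := by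
  obtain ⟨j, rfl⟩ : ∃ j, k = j + 1 := ⟨k - 1, by omega⟩
  rcases j.eq_zero_or_pos with rfl | hj
  · exact failureProfile_one
  · exact failureProfile_succ hj

/-! ### Phases and minimum success probability -/

theorem phaseRatio_arccos {c : ℝ} (hc : c ∈ Icc (0 : ℝ) 1) :
    phaseRatio (Real.arccos (1 - 2 * c)) = c := by
  rw [phaseRatio, Real.cos_arccos (by linarith [hc.2]) (by linarith [hc.1])]
  ring

theorem phaseRatio_strictMonoOn : StrictMonoOn phaseRatio (Icc 0 Real.pi) := fun x hx y hy h => by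
  have := Real.strictAntiOn_cos hx hy h
  unfold phaseRatio
  linarith

theorem phaseRatio_le_one (φ : ℝ) : phaseRatio φ ≤ 1 := by
  unfold phaseRatio
  linarith [Real.neg_one_le_cos φ]

theorem phaseMin_nonneg (k : ℕ) : 0 ≤ phaseMin k := Real.arccos_nonneg _

theorem phaseMin_le_pi (k : ℕ) : phaseMin k ≤ Real.pi := Real.arccos_le_pi _

theorem two_mul_maxAngle (k : ℕ) : 2 * maxAngle k = Real.pi / (2 * k + 1) := by
  unfold maxAngle
  field_simp
  ring

theorem one_sub_cos_two_mul_maxAngle (k : ℕ) : 1 - Real.cos (2 * maxAngle k) = 2 * piMax k := by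
  rw [Real.cos_two_mul, Real.cos_sq', sin_maxAngle_sq]
  ring

section

variable {k n : ℕ}

theorem phaseRatio_phaseMin (hk : 1 ≤ k) : phaseRatio (phaseMin k) = piMax k / piMax (k - 1) := by
  have hpred : 2 * (k : ℝ) - 1 = 2 * (k - 1 : ℕ) + 1 := by
    push_cast [Nat.cast_sub hk]
    ring
  have hlt : piMax k < piMax (k - 1) := piMax_strictAnti (by omega)
  have hmem : piMax k / piMax (k - 1) ∈ Icc 0 1 :=
    ⟨div_nonneg (piMax_pos _).le (piMax_pos _).le, div_le_one_of_le₀ hlt.le (piMax_pos _).le⟩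
  rw [← phaseRatio_arccos hmem, phaseMin, hpred, ← two_mul_maxAngle, ← two_mul_maxAngle,
    ← mul_one_sub, one_sub_cos_two_mul_maxAngle, one_sub_cos_two_mul_maxAngle,
    mul_div_mul_left _ _ two_ne_zero, mul_div_assoc]

theorem phaseRatio_mem_iff (hk : 1 ≤ k) {φ : ℝ} (hφ : φ ∈ Icc 0 Real.pi) :
    phaseRatio φ ∈ Ioc (piMax k / piMax (k - 1)) 1 ↔ φ ∈ Ioc (phaseMin k) Real.pi := by
  rw [← phaseRatio_phaseMin hk, mem_Ioc, mem_Ioc, phaseRatio_strictMonoOn.lt_iff_lt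
    ⟨phaseMin_nonneg k, phaseMin_le_pi k⟩ hφ]
  exact and_congr_right fun _ => iff_of_true (phaseRatio_le_one φ) hφ.2

theorem AdmissiblePhases.mem_Icc {φ : ℕ → ℝ} (h : AdmissiblePhases k n φ) :
    ∀ m ∈ Icc 1 n, φ m ∈ Icc 0 Real.pi := fun m hm =>
  ⟨(phaseMin_nonneg k).trans (h.1 m hm).1.le, (h.1 m hm).2⟩

theorem admissiblePhases_iff (hk : 1 ≤ k) {φ : ℕ → ℝ} (hφ : ∀ m ∈ Icc 1 n, φ m ∈ Icc 0 Real.pi) :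
    AdmissiblePhases k n φ ↔
      AdmissibleRatios (piMax k) (piMax (k - 1)) n (phaseRatio ∘ φ) :=
  and_congr (forall₂_congr fun m hm => (phaseRatio_mem_iff hk (hφ m hm)).symm)
    (forall₅_congr fun _ hi _ hj _ =>
      (phaseRatio_strictMonoOn.lt_iff_lt (hφ _ hj) (hφ _ hi)).symm)

theorem AdmissibleRatios.exists_admissiblePhases (hk : 1 ≤ k) {d : ℕ → ℝ}
    (hd : AdmissibleRatios (piMax k) (piMax (k - 1)) n d) :
    ∃ ψ, AdmissiblePhases k n ψ ∧ EqOn d (phaseRatio ∘ ψ) (Icc 1 n) := by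
  have heq : EqOn d (phaseRatio ∘ fun m => Real.arccos (1 - 2 * d m)) (Icc 1 n) := fun m hm =>
    (phaseRatio_arccos ⟨((failureProfile hk).ratio_pos (hd.1 m hm).1).le, (hd.1 m hm).2⟩).symm
  refine ⟨_, (admissiblePhases_iff hk fun m _ => ?_).2
    ⟨fun m hm => heq hm ▸ hd.1 m hm, hd.2.congr heq⟩, heq⟩
  exact ⟨Real.arccos_nonneg _, Real.arccos_le_pi _⟩

theorem range_subset (hk : 1 ≤ k) : range k ⊆ Icc 0 1 := fun _ hl =>
  ⟨(piMax_pos k).le.trans hl.1, hl.2.le.trans (failureProfile hk).le_one⟩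

theorem successProb_eq_iff {φ ψ l m : ℝ} (hl : l ∈ Icc (0 : ℝ) 1) (hm : m ∈ Icc (0 : ℝ) 1) :
    successProb k φ l = successProb k ψ m ↔
      failure (failPoly k) (phaseRatio φ) l = failure (failPoly k) (phaseRatio ψ) m := by
  rw [successProb_eq_one_sub_failure k φ hl, successProb_eq_one_sub_failure k ψ hm, sub_right_inj]

theorem isCrossing_iff (hk : 1 ≤ k) {φ ψ l : ℝ} :
    IsCrossing k φ ψ l ↔ l ∈ Ico (piMax k) (piMax (k - 1)) ∧
      failure (failPoly k) (phaseRatio φ) l = failure (failPoly k) (phaseRatio ψ) l :=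
  and_congr_right fun hl => successProb_eq_iff (range_subset hk hl) (range_subset hk hl)

theorem bddBelow_successProb (φ : ℕ → ℝ) (s : Subdivision k n) :
    BddBelow (Set.range fun l : range k => successProb k (φ (s.1 l)) l) :=
  ⟨0, by rintro _ ⟨l, rfl⟩; exact Complex.normSq_nonneg _⟩

theorem minSuccessOn_le (hk : 1 ≤ k) {φ : ℕ → ℝ} {w l : ℝ} (hl : l ∈ range k)
    (hw : ∀ m ∈ Icc 1 n, w ≤ failure (failPoly k) (phaseRatio (φ m)) l) (s : Subdivision k n) :
    minSuccessOn k n φ s ≤ 1 - w := by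
  refine (ciInf_le (bddBelow_successProb φ s) ⟨l, hl⟩).trans ?_
  rw [successProb_eq_one_sub_failure k _ (range_subset hk hl)]
  exact sub_le_sub_left (hw _ (s.2 _)) 1

theorem bddAbove_minSuccessOn (hk : 1 ≤ k) (φ : ℕ → ℝ) :
    BddAbove (Set.range fun s : Subdivision k n => minSuccessOn k n φ s) := by
  have hl : piMax k ∈ range k := ⟨le_rfl, (failureProfile hk).lt⟩
  refine ⟨1 - 0, ?_⟩
  rintro _ ⟨s, rfl⟩
  exact minSuccessOn_le hk hl (fun m _ => failure_nonneg (range_subset hk hl).2) s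

theorem le_minSuccess_iff (hk : 1 ≤ k) (hn : 1 ≤ n) {φ : ℕ → ℝ} {v : ℝ} :
    1 - v ≤ minSuccess k n φ ↔
      FailsAtMost (failPoly k) (piMax k) (piMax (k - 1)) n (phaseRatio ∘ φ) v := by
  rw [(failureProfile hk).failsAtMost_iff_forall_Ico]
  constructor
  · intro h l hl
    by_contra! hlt
    have : Nonempty (Subdivision k n) := ⟨⟨fun _ => 1, fun _ => ⟨le_rfl, hn⟩⟩⟩
    obtain ⟨m, hm, hmin⟩ := exists_min_image (Icc 1 n)
      (fun m => failure (failPoly k) (phaseRatio (φ m)) l) (finite_Icc 1 n) ⟨1, le_rfl, hn⟩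
    have hle := ciSup_le (minSuccessOn_le hk hl hmin)
    exact (h.trans hle).not_gt (sub_lt_sub_left (hlt m hm) 1)
  · intro h
    choose! s hs hsv using h
    have : Nonempty (range k) := ⟨⟨piMax k, le_rfl, (failureProfile hk).lt⟩⟩
    refine le_trans ?_ (le_ciSup (bddAbove_minSuccessOn hk φ) ⟨fun l => s l, fun l => hs l l.2⟩)
    refine le_ciInf fun l => ?_
    rw [successProb_eq_one_sub_failure k _ (range_subset hk l.2)]
    exact sub_le_sub_left (hsv l l.2) 1

theorem minSuccess_le_iff (hk : 1 ≤ k) (hn : 1 ≤ n) {φ ψ : ℕ → ℝ} :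
    minSuccess k n ψ ≤ minSuccess k n φ ↔ ∀ v,
      FailsAtMost (failPoly k) (piMax k) (piMax (k - 1)) n (phaseRatio ∘ ψ) v →
        FailsAtMost (failPoly k) (piMax k) (piMax (k - 1)) n (phaseRatio ∘ φ) v := by
  simp only [← le_minSuccess_iff hk hn]
  exact ⟨fun h v hv => hv.trans h, fun h => by simpa using h (1 - minSuccess k n ψ)⟩

theorem optimalPhases_iff (hk : 1 ≤ k) (hn : 1 ≤ n) {φ : ℕ → ℝ} (hφ : AdmissiblePhases k n φ) :
    OptimalPhases k n φ ↔ ∀ d, AdmissibleRatios (piMax k) (piMax (k - 1)) n d → ∀ v,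
      FailsAtMost (failPoly k) (piMax k) (piMax (k - 1)) n d v →
        FailsAtMost (failPoly k) (piMax k) (piMax (k - 1)) n (phaseRatio ∘ φ) v := by
  simp only [OptimalPhases, hφ, true_and, minSuccess_le_iff hk hn]
  refine ⟨fun h d hd v hdv => ?_, fun h ψ hψ => h _ ((admissiblePhases_iff hk hψ.mem_Icc).1 hψ)⟩
  obtain ⟨ψ, hψ, heq⟩ := hd.exists_admissiblePhases hk
  refine h ψ hψ v fun l hl => ?_
  obtain ⟨m, hm, hmv⟩ := hdv l hl
  exact ⟨m, hm, heq hm ▸ hmv⟩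

theorem forall_successProb_eq_lamKey_iff (hk : 1 ≤ k) {φ a : ℕ → ℝ}
    (hspan : IsSpanning (piMax k) (piMax (k - 1)) (keyRatio k) n (phaseRatio ∘ φ) a)
    (hφ : phaseRatio (φ n) ∈ Ioc (piMax k / piMax (k - 1)) 1) :
    (∀ m ∈ Icc 1 n, successProb k (φ m) (a (m - 1)) = successProb k (φ n) (lamKey k (φ n))) ↔
      ∀ m < n, failure (failPoly k) ((phaseRatio ∘ φ) (m + 1)) (a m) =
        failure (failPoly k) ((phaseRatio ∘ φ) n) (keyRatio k ((phaseRatio ∘ φ) n)) := by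
  have F := failureProfile hk
  have hsub : Icc (piMax k) (piMax (k - 1)) ⊆ Icc 0 1 := Icc_subset_Icc F.pos.le F.le_one
  have hiff {m : ℕ} (hm : m < n) := successProb_eq_iff (k := k) (φ := φ (m + 1)) (ψ := φ n)
    (hsub (F.left_mem_Icc hspan hm)) (hsub (F.key_mem_Icc hφ))
  rw [lamKey_eq]
  refine ⟨fun h m hm => (hiff hm).1 (h (m + 1) ⟨m.succ_pos, hm⟩), fun h m ⟨h1, hm⟩ => ?_⟩
  obtain ⟨i, rfl⟩ : ∃ i, m = i + 1 := ⟨m - 1, by omega⟩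
  exact (hiff hm).2 (h i hm)

end

end MultiphaseSearch

open MultiphaseSearch in
theorem theorem1 (k n : ℕ) (hk : 1 ≤ k) (hn : 1 ≤ n) (φ : ℕ → ℝ)
    (hφ : MultiphaseSearch.AdmissiblePhases k n φ) :
    (∀ m, 1 ≤ m → m < n → ∃! x, MultiphaseSearch.IsCrossing k (φ m) (φ (m + 1)) x) ∧
    ∀ a : ℕ → ℝ, MultiphaseSearch.IsDivision k n φ a →
      (MultiphaseSearch.OptimalPhases k n φ ↔
        ∀ m ∈ Set.Icc 1 n,
          MultiphaseSearch.successProb k (φ m) (a (m - 1)) =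
            MultiphaseSearch.successProb k (φ n) (MultiphaseSearch.lamKey k (φ n))) := by
  have F := failureProfile hk
  have hc := (admissiblePhases_iff hk hφ.mem_Icc).1 hφ
  refine ⟨fun m h1 h2 => ?_, fun a ⟨ha0, han, ham⟩ => ?_⟩
  · simp only [isCrossing_iff hk]
    exact F.existsUnique_failure_eq (hc.1 m ⟨h1, h2.le⟩) (hc.1 (m + 1) ⟨by omega, h2⟩)
      (hc.2 ⟨h1, h2.le⟩ ⟨by omega, h2⟩ m.lt_succ_self)
  have hcross := fun m h1 h2 => (isCrossing_iff hk).1 (ham m h1 h2)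
  have hspan := F.isSpanning_of_crossings hc ha0 han hcross
  rw [optimalPhases_iff hk hn hφ, forall_successProb_eq_lamKey_iff hk hspan (hc.1 n ⟨hn, le_rfl⟩)]
  exact F.forall_failsAtMost_iff hn hspan fun m h1 h2 => (hcross m h1 h2).2
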